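/- **Setting.** A graph $\Gamma=(\mathbf V,\mathbf E)$ consists of vertices, directed edges, an origin map $\mathrm o:\mathbf E\to\mathbf V$ and a fixed-point-free involution $e\mapsto -e$ of $\mathbf E$; put $\mathrm t(e)=\mathrm o(-e)$. Assume that $\Gamma$ is finite, connected, without loops ($\mathrm o(e)\ne \mathrm t(e)$), and has at least one edge. $\mathfrak C_1(\Gamma,\mathbb R)$ is the real vector space generated by the edges with $-e$ identified with the opposite of $e$, $\partial e=\mathrm t(e)-\mathrm o(e)$ and $H_1(\Gamma,\mathbb R)=\ker\partial$. $\mathfrak C^1(\Gamma,\mathbb R)$ is the space of functions $\eta:\mathbf E\to\mathbb R$ with $\eta(-e)=-\eta(e)$; for $f:\mathbf V\to\mathbb R$, $df(e)=f(\mathrm t(e))-f(\mathrm o(e))$; $H^1(\Gamma,\mathbb R)=\mathfrak C^1/\operatorname{Im} d$; and $\langle\cdot,\cdot\rangle$ is the pairing induced by $\langle\eta,e\rangle=\eta(e)$. A Hamiltonian is a family of strictly convex differentiable functions $\mathcal H(e,\cdot):\mathbb R\to\mathbb R$, $e\in\mathbf E$, with $\mathcal H(e,p)=\mathcal H(-e,-p)$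 and $\mathcal H(e,p)/|p|\to+\infty$ as $p\to\pm\infty$. Let $p_e$ be the minimizer of $\mathcal H(e,\cdot)$, let $\sigma(e,\cdot):[\mathcal H(e,p_e),\infty)\to[p_e,\infty)$ be the inverse of $\mathcal H(e,\cdot)|_{[p_e,\infty)}$, and let $\mathcal L(e,q)=\max_p(pq-\mathcal H(e,p))$. For $\omega\in\mathfrak C^1(\Gamma,\mathbb R)$ put $\mathcal H^\omega(e,p)=\mathcal H(e,p+\omega(e))$ and $\mathcal L^\omega(e,q)=\mathcal L(e,q)-q\,\omega(e)$. The tangent bundle $T\Gamma$ is $\mathbf E\times[0,\infty)$ with $(e,0)$ and $(-e,0)$ identified; a set is open if its trace on every $\{e\}\times[0,\infty)$ is open. Let $\mathbb M$ be the set of Borel probability measures $\mu$ on $T\Gamma$ with $\int q\,d\mu<\infty$ that are closed: $\int q\,df(e)\,d\mu(e,q)=0$ for all $f:\mathbf V\to\mathbb R$. The rotation vector of $\mu$ is $\rho(\mu)=\sum_{e}\big(\int_{\{e\}\times[0,\infty)}q\,d\mu\big)e$. Put $\beta(h)=\min\{\int\mathcal L\,d\mu:\mu\in\mathbb M,\ \rho(\mu)=h\}$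 for $h\in H_1(\Gamma,\mathbb R)$ (actions take values in $(-\infty,+\infty]$), and let $\alpha(c)=\max_{h}(\langle c,h\rangle-\beta(h))$ for $c\in H^1(\Gamma,\mathbb R)$ (Mather's $\alpha$-function). $\mathbb M_c$ is the set of $\mu\in\mathbb M$ with $\int\mathcal L^\omega d\mu=-\alpha(c)$ for the representatives $\omega$ of $c$. A measure is irreducible if it is an extreme point of $\mathbb M$. A function $u:\mathbf V\to\mathbb R$ is a subsolution of the discrete Hamilton–Jacobi equation at level $a$ if $\max_{\mathrm t(e)=x}\mathcal H^\omega(e,du(e))\le a$ for every vertex $x$. The critical value $\widetilde\alpha(c)$ is the minimum of the $a\in\mathbb R$ for which subsolutions exist; it depends only on the class $c$ of $\omega$. A path is a nonempty finite sequence of edges $(e_i)_{i=1}^M$ with $\mathrm t(e_i)=\mathrm o(e_{i+1})$; it is a circuit if $\mathrm o(e_1)=\mathrm t(e_M)$ and the vertices $\mathrm t(e_i)$ are distinct. The intrinsic length of $\zeta=(e_i)_{i=1}^M$ is $\sigma^\omega(\zeta,a)=\sum_i(\sigma(e_i,a)-\omega(e_i))$. A parametrized path $(e_i,q_i,T_i)_{i=1}^M$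 is a path with speeds $q_i\ge0$ and times $T_i>0$ such that: $T_i=1/q_i$ if $q_i>0$; if all $q_i$ vanish, then $\mathrm o(e_1)=\mathrm t(e_M)$; if $q_i=0$ and $e_{i+1}\neq-e_i$, then $q_{i+1}\ne0$; if $q_i\neq0$, then $\mathrm o(e_i)=\mathrm t(e_j)$ where $j$ is the largest index $<i$ with $q_j\ne0$, or $\mathrm o(e_i)=\mathrm o(e_1)$ if there is no such $j$; and if $j$ is the largest index with $q_j\neq 0$, then $\mathrm t(e_j)=\mathrm t(e_M)$. Its occupation measure is $\frac1{\sum_i T_i}\sum_i T_i\,\delta_{(e_i,q_i)}$. **Theorem 8.1.** Let $c\in H^1(\Gamma,\mathbb R)$ and let $\omega\in\mathfrak C^1(\Gamma,\mathbb R)$ be of cohomology class $c$. (i) The minima $\min_{\mu\in\mathbb M}\int\mathcal L^\omega\,d\mu$ and $\widetilde\alpha(c)$ exist, and $$\alpha(c)=-\min_{\mu\in\mathbb M}\int\mathcal L^\omega\,d\mu=\widetilde\alpha(c).$$ (ii) An irreducible measure belongs to $\mathbb M_c$ if and only if it is the occupation measure of a parametrized path $(e_i,q_i,T_i)_{i=1}^M$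 such that $\zeta=(e_i)_{i=1}^M$ is a circuit with $\sigma^\omega(\zeta,\alpha(c))=0$ and $$q_i=\frac{\partial\mathcal H}{\partial p}\big(e_i,\sigma(e_i,\alpha(c))\big)\qquad\text{for every } i.$$ -/

import Mathlib

open MeasureTheory Filter Set
open scoped NNReal ENNReal

noncomputable section

namespace MatherGraph

/-- A graph with vertex set `V` and set of directed edges `E`: the origin map and the
fixed-point-free involution reversing edges. Multiple edges are allowed. -/
structure DirGraph (V E : Type*) where
  /-- origin of an edge -/
  o : E → V
  /-- the reversed edge `-e` -/
  rev : E → E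
  rev_ne : ∀ e, rev e ≠ e
  rev_rev : ∀ e, rev (rev e) = e

namespace DirGraph

variable {V E : Type*} (Γ : DirGraph V E)

/-- terminal vertex of an edge -/
def t (e : E) : V := Γ.o (Γ.rev e)

/-- any two vertices are linked by a finite chain of concatenated edges -/
def Connected : Prop :=
  ∀ x y : V, Relation.ReflTransGen (fun a b => ∃ e, Γ.o e = a ∧ Γ.t e = b) x y

/-- no edge is a loop -/
def Loopless : Prop := ∀ e, Γ.o e ≠ Γ.t e

/-! ### Chains and homology -/

/-- The relations `(-e) + e = 0` among formal linear combinations of edges. -/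
def edgeRelations : Submodule ℝ (E →₀ ℝ) :=
  Submodule.span ℝ (range fun e => Finsupp.single e (1 : ℝ) + Finsupp.single (Γ.rev e) 1)

/-- `1`-chains with real coefficients: formal linear combinations of edges, where the reversed
edge is identified with the opposite of the edge. -/
abbrev Chain1 : Type _ := (E →₀ ℝ) ⧸ Γ.edgeRelations

/-- an edge as a `1`-chain -/
def edgeChain (e : E) : Γ.Chain1 := Submodule.Quotient.mk (Finsupp.single e 1)

/-- the boundary operator, `∂ e = t(e) - o(e)` -/
def boundary : Γ.Chain1 →ₗ[ℝ] (V →₀ ℝ) :=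
  Γ.edgeRelations.liftQ
    (Finsupp.linearCombination ℝ fun e =>
      Finsupp.single (Γ.t e) (1 : ℝ) - Finsupp.single (Γ.o e) 1)
    (by
      rw [edgeRelations, Submodule.span_le]
      rintro _ ⟨e, rfl⟩
      simp [t, Γ.rev_rev])

/-- first homology with real coefficients: the kernel of the boundary operator -/
abbrev H1 : Type _ := LinearMap.ker Γ.boundary

/-! ### Cochains and cohomology -/

/-- `1`-cochains: functions on edges that change sign under reversal -/
def cochain1 : Submodule ℝ (E → ℝ) where
  carrier := {η | ∀ e, η (Γ.rev e) = -η e}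
  add_mem' := by
    intro a b ha hb e
    simp only [mem_ofPred_eq, Pi.add_apply] at *
    rw [ha, hb]; ring
  zero_mem' := by intro e; simp
  smul_mem' := by
    intro r a ha e
    simp only [mem_ofPred_eq, Pi.smul_apply, smul_eq_mul] at *
    rw [ha]; ring

/-- the differential of a function on vertices, `dg(e) = g(t(e)) - g(o(e))` -/
def d : (V → ℝ) →ₗ[ℝ] Γ.cochain1 where
  toFun g := ⟨fun e => g (Γ.t e) - g (Γ.o e), by
    intro e
    simp [t, Γ.rev_rev]⟩
  map_add' := by
    intro f g
    ext e
    simp only [Pi.add_apply, Submodule.coe_add]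
    ring
  map_smul' := by
    intro r g
    ext e
    simp only [Pi.smul_apply, smul_eq_mul, RingHom.id_apply, Submodule.coe_smul]
    ring

/-- first cohomology with real coefficients -/
abbrev Cohomology1 : Type _ := Γ.cochain1 ⧸ LinearMap.range Γ.d

/-- the cohomology class of a `1`-cochain -/
def cohClass (ω : Γ.cochain1) : Γ.Cohomology1 := Submodule.Quotient.mk ω

/-- the pairing between `1`-cochains and `1`-chains, `⟨η, ∑ aₑ e⟩ = ∑ aₑ η(e)` -/
def pairing : Γ.cochain1 →ₗ[ℝ] Γ.Chain1 →ₗ[ℝ] ℝ where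
  toFun η := Γ.edgeRelations.liftQ (Finsupp.linearCombination ℝ (η : E → ℝ)) (by
    rw [edgeRelations, Submodule.span_le]
    rintro _ ⟨e, rfl⟩
    have h : (η : E → ℝ) (Γ.rev e) = -(η : E → ℝ) e := η.2 e
    simp [h])
  map_add' := by
    intro f g
    ext e
    simp
  map_smul' := by
    intro r g
    ext e
    simp

theorem pairing_edgeChain (η : Γ.cochain1) (e : E) :
    Γ.pairing η (Γ.edgeChain e) = (η : E → ℝ) e := by
  simp [pairing, edgeChain]

theorem pairing_d (g : V → ℝ) (z : Γ.Chain1) :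
    Γ.pairing (Γ.d g) z = Finsupp.linearCombination ℝ g (Γ.boundary z) := by
  have h : Γ.pairing (Γ.d g) = (Finsupp.linearCombination ℝ g).comp Γ.boundary := by
    ext e
    simp [pairing, boundary, d]
  rw [h]; rfl

/-- the induced pairing between first cohomology and first homology -/
def cohPairing : Γ.Cohomology1 →ₗ[ℝ] Γ.H1 →ₗ[ℝ] ℝ :=
  (LinearMap.range Γ.d).liftQ
    ((LinearMap.lcomp ℝ ℝ (LinearMap.ker Γ.boundary).subtype).comp Γ.pairing)
    (by
      rintro _ ⟨g, rfl⟩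
      rw [LinearMap.mem_ker]
      ext h
      have hh : Γ.boundary (h : Γ.Chain1) = 0 := h.2
      simp [pairing_d, hh])

/-! ### The tangent bundle -/

/-- the identification `(e, 0) ∼ (-e, 0)` on `E × [0, ∞)` -/
def tangentSetoid : Setoid (E × ℝ≥0) where
  r a b := a = b ∨ (b.1 = Γ.rev a.1 ∧ a.2 = 0 ∧ b.2 = 0)
  iseqv :=
    { refl := fun _ => Or.inl rfl
      symm := by
        rintro a b (h | ⟨h1, h2, h3⟩)
        · exact Or.inl h.symm
        · exact Or.inr ⟨by rw [h1, Γ.rev_rev], h3, h2⟩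
      trans := by
        rintro a b c (rfl | ⟨h1, h2, h3⟩) (rfl | ⟨k1, k2, k3⟩)
        · exact Or.inl rfl
        · exact Or.inr ⟨k1, k2, k3⟩
        · exact Or.inr ⟨h1, h2, h3⟩
        · refine Or.inl (Prod.ext ?_ ?_)
          · rw [k1, h1, Γ.rev_rev]
          · rw [h2, k3] }

/-- the tangent bundle `TΓ` -/
def Tangent : Type _ := Quotient Γ.tangentSetoid

/-- the point `(e, q)` of the tangent bundle -/
def pt (e : E) (q : ℝ≥0) : Γ.Tangent := Quotient.mk Γ.tangentSetoid (e, q)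

theorem pt_zero_rev (e : E) : Γ.pt (Γ.rev e) 0 = Γ.pt e 0 :=
  (Quotient.sound (s := Γ.tangentSetoid) (Or.inr ⟨rfl, rfl, rfl⟩)).symm

/-- the function on the tangent bundle given by a function of `(e, q)` that respects the
identification -/
def lift {X : Type*} (F : E → ℝ≥0 → X) (hF : ∀ e, F (Γ.rev e) 0 = F e 0) : Γ.Tangent → X :=
  Quotient.lift (s := Γ.tangentSetoid) (fun a => F a.1 a.2) (by
    rintro ⟨e, q⟩ ⟨f, s⟩ (h | ⟨h1, h2, h3⟩)
    · rw [h]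
    · simp only at h1 h2 h3 ⊢
      rw [h1, h2, h3, hF])

theorem lift_pt {X : Type*} (F : E → ℝ≥0 → X) (hF : ∀ e, F (Γ.rev e) 0 = F e 0)
    (e : E) (q : ℝ≥0) : Γ.lift F hF (Γ.pt e q) = F e q := rfl

/-- A set is open in the tangent bundle when its trace on every fiber is open. -/
instance : TopologicalSpace Γ.Tangent :=
  ⨆ e : E, TopologicalSpace.coinduced (Γ.pt e) inferInstance

/-- The tangent bundle carries its Borel sigma-algebra. -/
instance : MeasurableSpace Γ.Tangent := borel _

instance : BorelSpace Γ.Tangent := ⟨rfl⟩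

theorem isOpen_iff (A : Set Γ.Tangent) : IsOpen A ↔ ∀ e, IsOpen (Γ.pt e ⁻¹' A) := by
  rw [isOpen_iSup_iff]
  exact forall_congr' fun e => isOpen_coinduced

/-- the fiber `{e} × [0, ∞)` -/
def fiber (e : E) : Set Γ.Tangent := range (Γ.pt e)

/-- the speed `q` of a point `(e, q)` of the tangent bundle -/
def speed : Γ.Tangent → ℝ≥0 := Γ.lift (fun _ q => q) (fun _ => rfl)

/-! ### Measures on the tangent bundle -/

/-- Borel probability measures with finite first moment -/
def probMeasures : Set (Measure Γ.Tangent) :=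
  {μ | IsProbabilityMeasure μ ∧ ∫⁻ z, (Γ.speed z : ℝ≥0∞) ∂μ ≠ ⊤}

/-- the function `(e, q) ↦ ⟨ω, q e⟩` on the tangent bundle -/
def cochainFun (ω : Γ.cochain1) : Γ.Tangent → ℝ :=
  Γ.lift (fun e q => (q : ℝ) * (ω : E → ℝ) e) (by intro e; simp)

/-- the closed probability measures `𝕄`: those that integrate every differential to zero -/
def closedMeasures : Set (Measure Γ.Tangent) :=
  {μ | μ ∈ Γ.probMeasures ∧ ∀ f : V → ℝ, ∫ z, Γ.cochainFun (Γ.d f) z ∂μ = 0}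

/-- the `1`-chain `∑ₑ (∫_{fiber e} q dμ) e` attached to a measure (its rotation vector when the
measure is closed) -/
def rotation [Fintype E] (μ : Measure Γ.Tangent) : Γ.Chain1 :=
  ∑ e : E, (∫ z in Γ.fiber e, (Γ.speed z : ℝ) ∂μ) • Γ.edgeChain e

/-- A closed probability measure is irreducible if it is an extreme point of `𝕄`. -/
def Irreducible (μ : Measure Γ.Tangent) : Prop :=
  μ ∈ extremePoints ℝ≥0 Γ.closedMeasures

/-! ### Paths -/

/-- a path made up of `n + 1` concatenated edges -/
structure EdgePath where
  n : ℕ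
  edge : Fin (n + 1) → E
  concat : ∀ i : Fin n, Γ.t (edge i.castSucc) = Γ.o (edge i.succ)

variable {Γ}

/-- origin of a path -/
def EdgePath.origin (ζ : Γ.EdgePath) : V := Γ.o (ζ.edge 0)

/-- terminal vertex of a path -/
def EdgePath.terminus (ζ : Γ.EdgePath) : V := Γ.t (ζ.edge (Fin.last ζ.n))

/-- a circuit is a closed path without repetition of terminal vertices of its edges -/
def EdgePath.IsCircuit (ζ : Γ.EdgePath) : Prop :=
  ζ.origin = ζ.terminus ∧ ∀ i j, Γ.t (ζ.edge i) = Γ.t (ζ.edge j) → i = j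

variable (Γ)

/-- A parametrized path: every edge of a path carries an average speed `q ≥ 0` and a time `T > 0`,
with `T = 1 / q` if `q > 0`. Edges of zero speed represent floating back and forth along an edge;
a point that floats starts moving again from the vertex where it stopped moving (from the origin
of the path if it has not moved before), and the last vertex reached by moving is the terminal
vertex of the path. -/
structure ParamPath extends EdgePath Γ where
  speed : Fin (n + 1) → ℝ≥0
  time : Fin (n + 1) → ℝ
  time_pos : ∀ i, 0 < time i
  time_eq : ∀ i, speed i ≠ 0 → time i = 1 / (speed i : ℝ)
  closed_of_still : (∀ i, speed i = 0) → toEdgePath.origin = toEdgePath.terminus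
  float : ∀ i : Fin n, speed i.castSucc = 0 → edge i.succ ≠ Γ.rev (edge i.castSucc) →
    speed i.succ ≠ 0
  resume : ∀ i j, j < i → speed i ≠ 0 → speed j ≠ 0 → (∀ k, j < k → k < i → speed k = 0) →
    Γ.o (edge i) = Γ.t (edge j)
  start : ∀ i, speed i ≠ 0 → (∀ k, k < i → speed k = 0) →
    Γ.o (edge i) = toEdgePath.origin
  arrive : ∀ j, speed j ≠ 0 → (∀ k, j < k → speed k = 0) →
    Γ.t (edge j) = toEdgePath.terminus

variable {Γ}

/-- the total time of a parametrized path -/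
def ParamPath.totalTime (ξ : Γ.ParamPath) : ℝ := ∑ i, ξ.time i

/-- the occupation measure `(1 / T) ∑ᵢ Tᵢ δ(eᵢ, qᵢ)` of a parametrized path -/
def ParamPath.occupation (ξ : Γ.ParamPath) : Measure Γ.Tangent :=
  ∑ i, ENNReal.ofReal (ξ.time i / ξ.totalTime) • Measure.dirac (Γ.pt (ξ.edge i) (ξ.speed i))

end DirGraph

open DirGraph

/-! ### Hamiltonians and Lagrangians -/

/-- A Hamiltonian on a graph: a family of strictly convex, differentiable, superlinear functions
labeled by the edges and compatible with the reversal of edges. -/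
structure Hamiltonian {V E : Type*} (Γ : DirGraph V E) where
  toFun : E → ℝ → ℝ
  symm : ∀ e p, toFun e p = toFun (Γ.rev e) (-p)
  strictConvex : ∀ e, StrictConvexOn ℝ univ (toFun e)
  differentiable : ∀ e, Differentiable ℝ (toFun e)
  superlinear_top : ∀ e, Tendsto (fun p => toFun e p / |p|) atTop atTop
  superlinear_bot : ∀ e, Tendsto (fun p => toFun e p / |p|) atBot atTop

namespace Hamiltonian

variable {V E : Type*} {Γ : DirGraph V E} (H : Hamiltonian Γ)

/-- the modified Hamiltonian `H^ω(e, p) = H(e, p + ⟨ω, e⟩)` -/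
def modified (ω : Γ.cochain1) (e : E) (p : ℝ) : ℝ := H.toFun e (p + (ω : E → ℝ) e)

/-- the global minimizer `pₑ` of `H(e, ·)` -/
def pMin (e : E) : ℝ := Classical.epsilon fun p => ∀ r, H.toFun e p ≤ H.toFun e r

/-- `σ(e, ·)`, the inverse of the restriction of `H(e, ·)` to `[pₑ, ∞)`; it is meaningful on
`[H(e, pₑ), ∞)` -/
def sigma (e : E) (a : ℝ) : ℝ := Function.invFunOn (H.toFun e) (Ici (H.pMin e)) a

/-- the intrinsic length `σ^ω(ζ, a) = ∑ᵢ (σ(eᵢ, a) - ⟨ω, eᵢ⟩)` of a path -/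
def intrinsicLength (ω : Γ.cochain1) (ζ : Γ.EdgePath) (a : ℝ) : ℝ :=
  ∑ i, (H.sigma (ζ.edge i) a - (ω : E → ℝ) (ζ.edge i))

/-- the Lagrangian, the convex conjugate of the Hamiltonian -/
def lagrangian (e : E) (q : ℝ) : ℝ := ⨆ p : ℝ, (p * q - H.toFun e p)

theorem lagrangian_rev (e : E) (q : ℝ) : H.lagrangian (Γ.rev e) (-q) = H.lagrangian e q := by
  unfold lagrangian
  refine Function.Surjective.iSup_congr (fun p : ℝ => -p) neg_surjective fun p => ?_
  have h := H.symm e (-p)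
  rw [neg_neg] at h
  rw [h]; ring

/-- the modified Lagrangian `L^ω(e, q) = L(e, q) - ⟨ω, q e⟩`, as a function on the tangent
bundle -/
def modLagrangian (ω : Γ.cochain1) : Γ.Tangent → ℝ :=
  Γ.lift (fun e q => H.lagrangian e q - (q : ℝ) * (ω : E → ℝ) e) (by
    intro e
    have h := H.lagrangian_rev e 0
    rw [neg_zero] at h
    simp [h])

/-- the action `∫ L^ω dμ`, an extended real number: the integral of the positive part, which may
be infinite, minus the integral of the negative part -/
def action (ω : Γ.cochain1) (μ : Measure Γ.Tangent) : EReal :=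
  ((∫⁻ z, ENNReal.ofReal (H.modLagrangian ω z) ∂μ : ℝ≥0∞) : EReal) -
    ((∫⁻ z, ENNReal.ofReal (-H.modLagrangian ω z) ∂μ : ℝ≥0∞) : EReal)

/-- Mather's `β` function: the minimal action of closed probability measures with rotation
vector `h` -/
def beta [Fintype E] (h : Γ.H1) : ℝ :=
  (sInf (H.action 0 '' {μ | μ ∈ Γ.closedMeasures ∧ Γ.rotation μ = (h : Γ.Chain1)})).toReal

/-- Mather's `α` function: the convex conjugate of `β` -/
def alpha [Fintype E] (c : Γ.Cohomology1) : ℝ :=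
  ⨆ h : Γ.H1, (Γ.cohPairing c h - H.beta h)

/-- the Mather measures `𝕄_c` of cohomology `c` -/
def matherMeasures [Fintype E] (c : Γ.Cohomology1) : Set (Measure Γ.Tangent) :=
  {μ | μ ∈ Γ.closedMeasures ∧
    ∀ ω : Γ.cochain1, Γ.cohClass ω = c → H.action ω μ = ((-H.alpha c : ℝ) : EReal)}

/-! ### The discrete Hamilton-Jacobi equation -/

/-- `u` is a subsolution at level `a` of the discrete Hamilton-Jacobi equation for `H^ω`: at
every vertex `x`, the maximum of `H^ω(e, ⟨du, e⟩)` over the edges `e` that end at `x` is at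
most `a`. -/
def IsSubsolution (ω : Γ.cochain1) (a : ℝ) (u : V → ℝ) : Prop :=
  ∀ x : V, ∀ e : E, Γ.t e = x → H.modified ω e ((Γ.d u : E → ℝ) e) ≤ a

/-- the levels at which the equation for `H^ω` admits subsolutions -/
def subsolutionLevels (ω : Γ.cochain1) : Set ℝ := {a | ∃ u : V → ℝ, H.IsSubsolution ω a u}

theorem subsolutionLevels_add_d (ω : Γ.cochain1) (w : V → ℝ) :
    H.subsolutionLevels (ω + Γ.d w) = H.subsolutionLevels ω := by
  ext a
  constructor
  · rintro ⟨u, hu⟩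
    refine ⟨u + w, fun x e he => ?_⟩
    have := hu x e he
    simp only [modified, map_add, Submodule.coe_add, Pi.add_apply] at this ⊢
    convert this using 2
    ring
  · rintro ⟨u, hu⟩
    refine ⟨u - w, fun x e he => ?_⟩
    have := hu x e he
    simp only [modified, map_sub, Submodule.coe_add, Submodule.coe_sub, Pi.add_apply,
      Pi.sub_apply] at this ⊢
    convert this using 2
    ring

/-- the critical value `α̃(c)`: the minimal level at which the discrete Hamilton-Jacobi equation
for `H^ω` admits subsolutions, where `ω` is any representative of `c` -/
def criticalValue (c : Γ.Cohomology1) : ℝ :=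
  Quotient.liftOn' c (fun ω => sInf (H.subsolutionLevels ω)) (by
    intro ω ω' h
    obtain ⟨w, hw⟩ := (Submodule.quotientRel_def _).1 h
    have h1 : ω = ω' + Γ.d w := by rw [hw]; abel
    rw [h1, subsolutionLevels_add_d])

theorem criticalValue_cohClass (ω : Γ.cochain1) :
    H.criticalValue (Γ.cohClass ω) = sInf (H.subsolutionLevels ω) := rfl

end Hamiltonian

end MatherGraph

end

/-!
The function `u ↦ maxₑ H^ω(e, du(e))` is convex and coercive in `du`, so it attains a minimum `a`,
which is the critical value (`Hamiltonian.exists_minimax`). Fenchel's inequality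
`L^ω(e, q) ≥ q du(e) - a` for the minimizing `u`, integrated against a closed measure, bounds the
action below by `-a` (`Hamiltonian.neg_le_action`). The bound is attained: by first-order
optimality at the minimax, zero is a convex combination of the differentials of
`u ↦ H^ω(e, du(e))` over the edges that realize the maximum
(`Hamiltonian.exists_multipliers`), and the coefficients are the weights of a closed measure
supported by the vectors `(e, H'(e, du(e) + ω(e)))`, whose action is `-a`
(`Hamiltonian.exists_minimizer`). Since `β` minimizes the action at a given rotation vector, and
every homology class is a rotation vector, conjugation gives `α(c) = a` (`Hamiltonian.alpha_eq`).

A measure of action `-a` is carried by the equality set of Fenchel's inequality: the vectors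
`(e, H'(e, σ(e, a)))` over the edges with `du(e) + ω(e) = σ(e, a)` (`Hamiltonian.ae_calibrated`).
If such a measure charges a vector of zero speed, then it dominates a multiple of the Dirac measure
there, which is closed. Otherwise conservation of the flow allows every charged edge to be
continued by a charged edge, so that there is a circuit of charged edges, and the measure dominates
a multiple of the occupation measure of this circuit. An extreme point is equal to any closed
measure of which it dominates a multiple (`DirGraph.Irreducible.eq_of_smul_le`), whence one
direction of the characterization (`Hamiltonian.exists_circuit_of_irreducible`). The intrinsic
length vanishes because `σ(e, a) - ω(e) = du(e)` along the circuit. Conversely, on a circuit a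
parametrization either moves along every edge or rests all the time
(`DirGraph.ParamPath.moving_or_still`), and in both cases the action is read off from
`L(e, q) = q σ(e, a) - a` (`Hamiltonian.action_occupation`).
-/

namespace MatherGraph

namespace DirGraph

variable {V E : Type*} {Γ : DirGraph V E}

/-! ### The tangent bundle as a measurable space -/

theorem t_rev (e : E) : Γ.t (Γ.rev e) = Γ.o e := by rw [t, Γ.rev_rev]

theorem exists_pt_eq (z : Γ.Tangent) : ∃ e q, z = Γ.pt e q := by
  induction z using Quotient.inductionOn with
  | h a => exact ⟨a.1, a.2, rfl⟩

theorem pt_eq_iff {e f : E} {q s : ℝ≥0} :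
    Γ.pt e q = Γ.pt f s ↔ (e = f ∧ q = s) ∨ (f = Γ.rev e ∧ q = 0 ∧ s = 0) :=
  (Quotient.eq (r := Γ.tangentSetoid)).trans (or_congr Prod.ext_iff Iff.rfl)

@[simp] theorem speed_pt (e : E) (q : ℝ≥0) : Γ.speed (Γ.pt e q) = q := rfl

@[simp] theorem cochainFun_pt (η : Γ.cochain1) (e : E) (q : ℝ≥0) :
    Γ.cochainFun η (Γ.pt e q) = q * (η : E → ℝ) e := rfl

theorem d_apply (f : V → ℝ) (e : E) : (Γ.d f : E → ℝ) e = f (Γ.t e) - f (Γ.o e) := rfl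

theorem continuous_lift {X : Type*} [TopologicalSpace X] {F : E → ℝ≥0 → X}
    (hF : ∀ e, F (Γ.rev e) 0 = F e 0) (hc : ∀ e, Continuous (F e)) : Continuous (Γ.lift F hF) := by
  rw [continuous_def]
  intro s hs
  rw [isOpen_iff]
  exact fun e => hs.preimage (hc e)

theorem isClosed_of_forall_fiber {A : Set Γ.Tangent} (h : ∀ e, IsClosed (Γ.pt e ⁻¹' A)) :
    IsClosed A := by
  rw [← isOpen_compl_iff, isOpen_iff]
  exact fun e => (h e).isOpen_compl

instance : T1Space Γ.Tangent where
  t1 z := isClosed_of_forall_fiber fun e => by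
    refine Set.Subsingleton.isClosed fun q hq s hs => ?_
    have h : Γ.pt e q = Γ.pt e s := (mem_singleton_iff.1 hq).trans (mem_singleton_iff.1 hs).symm
    exact congrArg Γ.speed h

theorem continuous_speed : Continuous Γ.speed :=
  continuous_lift _ fun _ => continuous_id

theorem continuous_cochainFun (η : Γ.cochain1) : Continuous (Γ.cochainFun η) :=
  continuous_lift _ fun e => by fun_prop

theorem isClosed_fiber (e : E) : IsClosed (Γ.fiber e) := by
  refine isClosed_of_forall_fiber fun f => ?_
  by_cases h : f = e
  · subst h
    have : Γ.pt f ⁻¹' Γ.fiber f = univ := eq_univ_of_forall fun q => ⟨q, rfl⟩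
    rw [this]
    exact isClosed_univ
  · refine Set.Subsingleton.isClosed ?_
    have key : ∀ q ∈ Γ.pt f ⁻¹' Γ.fiber e, q = 0 := by
      rintro q ⟨s, hs⟩
      rcases pt_eq_iff.1 hs with ⟨h1, -⟩ | ⟨-, -, h2⟩
      · exact absurd h1.symm h
      · exact h2
    exact fun q hq s hs => (key q hq).trans (key s hs).symm

/-! ### Closed measures -/

theorem integrable_speed {μ : Measure Γ.Tangent} (hμ : μ ∈ Γ.probMeasures) :
    Integrable (fun z => (Γ.speed z : ℝ)) μ := by
  refine ⟨(NNReal.continuous_coe.comp continuous_speed).aestronglyMeasurable, ?_⟩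
  rw [hasFiniteIntegral_iff_enorm]
  refine lt_of_le_of_lt (lintegral_mono fun z => ?_) (lt_top_iff_ne_top.2 hμ.2)
  simp

theorem integrable_cochainFun [Finite E] {μ : Measure Γ.Tangent} (hμ : μ ∈ Γ.probMeasures)
    (η : Γ.cochain1) : Integrable (Γ.cochainFun η) μ := by
  have := Fintype.ofFinite E
  refine ((integrable_speed hμ).mul_const (∑ e, |(η : E → ℝ) e|)).mono'
    (continuous_cochainFun η).aestronglyMeasurable (Eventually.of_forall fun z => ?_)
  obtain ⟨e, q, rfl⟩ := exists_pt_eq z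
  rw [cochainFun_pt, speed_pt, Real.norm_eq_abs, abs_mul,
    abs_of_nonneg (NNReal.coe_nonneg q)]
  gcongr
  exact Finset.single_le_sum (f := fun e => |(η : E → ℝ) e|) (fun _ _ => abs_nonneg _)
    (Finset.mem_univ e)

/-- The chain `q e` carried by the point `(e, q)` of the tangent bundle. -/
noncomputable def velocity : Γ.Tangent → Γ.Chain1 :=
  Γ.lift (fun e q => (q : ℝ) • Γ.edgeChain e) (by intro e; simp)

@[simp] theorem velocity_pt (e : E) (q : ℝ≥0) :
    velocity (Γ.pt e q) = (q : ℝ) • Γ.edgeChain e := rfl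

theorem pairing_velocity (η : Γ.cochain1) (z : Γ.Tangent) :
    Γ.pairing η (velocity z) = Γ.cochainFun η z := by
  obtain ⟨e, q, rfl⟩ := exists_pt_eq z
  simp [pairing_edgeChain]

/-- The fibers of an edge and of its reverse meet at the zero vector, which therefore shows up
in two terms of the sum; it contributes nothing to either. -/
theorem sum_indicator_fiber [Fintype E] (z : Γ.Tangent) :
    ∑ e, (Γ.fiber e).indicator (fun z => (Γ.speed z : ℝ)) z • Γ.edgeChain e = velocity z := by
  classical
  obtain ⟨f, q, rfl⟩ := exists_pt_eq z
  rw [Finset.sum_eq_single f]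
  · rw [indicator_of_mem (show Γ.pt f q ∈ Γ.fiber f from mem_range_self q)]
    rfl
  · intro e _ he
    by_cases hm : Γ.pt f q ∈ Γ.fiber e
    · obtain ⟨s, hs⟩ := hm
      rcases pt_eq_iff.1 hs with ⟨h1, -⟩ | ⟨-, -, h2⟩
      · exact absurd h1 he
      · subst h2
        rw [indicator_of_mem (show Γ.pt f 0 ∈ Γ.fiber e from ⟨s, hs⟩)]
        simp
    · rw [indicator_of_notMem hm, zero_smul]
  · exact fun h => absurd (Finset.mem_univ f) h

theorem pairing_rotation [Fintype E] {μ : Measure Γ.Tangent} (hμ : μ ∈ Γ.probMeasures)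
    (η : Γ.cochain1) : Γ.pairing η (Γ.rotation μ) = ∫ z, Γ.cochainFun η z ∂μ := by
  have key : ∀ z, Γ.cochainFun η z =
      ∑ e, (Γ.fiber e).indicator (fun z => (Γ.speed z : ℝ)) z * (η : E → ℝ) e := fun z => by
    rw [← pairing_velocity, ← sum_indicator_fiber, map_sum]
    simp [pairing_edgeChain]
  have hm : ∀ e, MeasurableSet (Γ.fiber e) := fun e => (isClosed_fiber e).measurableSet
  simp_rw [key]
  rw [integral_finsetSum _ fun e _ =>
    ((integrable_speed hμ).indicator (hm e)).mul_const _, rotation, map_sum]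
  refine Finset.sum_congr rfl fun e _ => ?_
  rw [integral_mul_const, integral_indicator (hm e), map_smul, pairing_edgeChain, smul_eq_mul]

theorem rotation_mem_H1 [Fintype E] {μ : Measure Γ.Tangent} (hμ : μ ∈ Γ.closedMeasures) :
    Γ.rotation μ ∈ LinearMap.ker Γ.boundary := by
  classical
  rw [LinearMap.mem_ker]
  ext x
  have h := pairing_d Γ (Pi.single x 1) (Γ.rotation μ)
  rw [pairing_rotation hμ.1, hμ.2] at h
  rw [Finsupp.coe_zero, Pi.zero_apply, h, Finsupp.linearCombination_apply, Finsupp.sum]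
  simp only [smul_eq_mul, Pi.single_apply, mul_ite, mul_one, mul_zero, Finset.sum_ite_eq',
    Finsupp.mem_support_iff]
  simp

/-! ### Measures with finite support -/

/-- The measure `∑ᵢ wᵢ δ(zᵢ)` on the tangent bundle. -/
noncomputable def atomic {ι : Type*} [Fintype ι] (w : ι → ℝ) (z : ι → Γ.Tangent) :
    Measure Γ.Tangent :=
  ∑ i, ENNReal.ofReal (w i) • Measure.dirac (z i)

section Atomic

variable {ι : Type*} [Fintype ι] {w : ι → ℝ} {z : ι → Γ.Tangent}

theorem integrable_atomic (F : Γ.Tangent → ℝ) : Integrable F (atomic w z) :=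
  integrable_finsetSum_measure.2 fun _ _ =>
    (integrable_dirac (by simp)).smul_measure ENNReal.ofReal_ne_top

theorem integral_atomic (hw : ∀ i, 0 ≤ w i) (F : Γ.Tangent → ℝ) :
    ∫ x, F x ∂(atomic w z) = ∑ i, w i * F (z i) := by
  rw [atomic, integral_finsetSum_measure fun _ _ =>
    (integrable_dirac (by simp)).smul_measure ENNReal.ofReal_ne_top]
  refine Finset.sum_congr rfl fun i _ => ?_
  rw [integral_smul_measure, integral_dirac, ENNReal.toReal_ofReal (hw i), smul_eq_mul]

theorem atomic_mem_probMeasures (hw : ∀ i, 0 ≤ w i) (h1 : ∑ i, w i = 1) :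
    atomic w z ∈ Γ.probMeasures := by
  constructor
  · constructor
    simp [atomic, ← ENNReal.ofReal_sum_of_nonneg (fun i _ => hw i), h1]
  · rw [atomic, lintegral_finsetSum_measure]
    refine ENNReal.sum_ne_top.2 fun i _ => ?_
    rw [lintegral_smul_measure, lintegral_dirac, smul_eq_mul]
    exact ENNReal.mul_ne_top ENNReal.ofReal_ne_top ENNReal.coe_ne_top

theorem atomic_mem_closedMeasures (hw : ∀ i, 0 ≤ w i) (h1 : ∑ i, w i = 1)
    (hd : ∀ f : V → ℝ, ∑ i, w i * Γ.cochainFun (Γ.d f) (z i) = 0) :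
    atomic w z ∈ Γ.closedMeasures :=
  ⟨atomic_mem_probMeasures hw h1, fun f => by rw [integral_atomic hw, hd]⟩

theorem rotation_atomic [Fintype E] (hw : ∀ i, 0 ≤ w i) :
    Γ.rotation (atomic w z) = ∑ i, w i • velocity (z i) := by
  have h : ∀ e, ∫ x in Γ.fiber e, (Γ.speed x : ℝ) ∂(atomic w z) =
      ∑ i, w i * (Γ.fiber e).indicator (fun x => (Γ.speed x : ℝ)) (z i) := fun e => by
    rw [← integral_indicator (isClosed_fiber e).measurableSet, integral_atomic hw]
  simp_rw [rotation, h, Finset.sum_smul, ← sum_indicator_fiber, Finset.smul_sum, smul_smul]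
  exact Finset.sum_comm

end Atomic

theorem dirac_zero_mem_closedMeasures (e : E) :
    Measure.dirac (Γ.pt e 0) ∈ Γ.closedMeasures := by
  have h := atomic_mem_closedMeasures (Γ := Γ) (ι := Unit) (w := fun _ => 1)
    (z := fun _ => Γ.pt e 0) (by simp) (by simp) (by simp)
  simpa [atomic] using h

/-- The velocity `r` along the edge `e`, with a sign: the point `(e, r)` for `r ≥ 0`, and
`(-e, -r)` for `r ≤ 0`. -/
noncomputable def signedPt (Γ : DirGraph V E) (e : E) (r : ℝ) : Γ.Tangent :=
  if 0 ≤ r then Γ.pt e r.toNNReal else Γ.pt (Γ.rev e) (-r).toNNReal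

theorem cochainFun_signedPt (η : Γ.cochain1) (e : E) (r : ℝ) :
    Γ.cochainFun η (signedPt Γ e r) = r * (η : E → ℝ) e := by
  unfold signedPt
  split_ifs with h
  · rw [cochainFun_pt, Real.coe_toNNReal _ h]
  · rw [cochainFun_pt, Real.coe_toNNReal _ (by linarith), η.2 e]
    ring

theorem edgeChain_rev (e : E) : Γ.edgeChain (Γ.rev e) = -Γ.edgeChain e := by
  rw [eq_neg_iff_add_eq_zero, add_comm, edgeChain, edgeChain, ← Submodule.Quotient.mk_add,
    Submodule.Quotient.mk_eq_zero]
  exact Submodule.subset_span ⟨e, rfl⟩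

theorem velocity_signedPt (e : E) (r : ℝ) :
    velocity (signedPt Γ e r) = r • Γ.edgeChain e := by
  unfold signedPt
  split_ifs with h
  · rw [velocity_pt, Real.coe_toNNReal _ h]
  · rw [velocity_pt, Real.coe_toNNReal _ (by linarith), edgeChain_rev]
    simp

theorem exists_chain_eq_sum [Fintype E] (h : Γ.Chain1) :
    ∃ g : E → ℝ, h = ∑ e, g e • Γ.edgeChain e := by
  obtain ⟨g, rfl⟩ := Submodule.Quotient.mk_surjective _ h
  refine ⟨g, ?_⟩
  change Γ.edgeRelations.mkQ g = _
  conv_lhs => rw [← Finsupp.univ_sum_single g]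
  rw [map_sum]
  refine Finset.sum_congr rfl fun e _ => ?_
  change _ = g e • Γ.edgeRelations.mkQ (Finsupp.single e 1)
  rw [← map_smul, Finsupp.smul_single, smul_eq_mul, mul_one]

/-- Every homology class is the rotation vector of a closed measure with finite support. -/
theorem exists_atomic_rotation_eq [Fintype E] [Nonempty E] (h : Γ.H1) :
    ∃ z : E → Γ.Tangent, atomic (fun _ => (Fintype.card E : ℝ)⁻¹) z ∈ Γ.closedMeasures ∧
      Γ.rotation (atomic (fun _ => (Fintype.card E : ℝ)⁻¹) z) = (h : Γ.Chain1) := by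
  obtain ⟨g, hg⟩ := exists_chain_eq_sum (h : Γ.Chain1)
  have hN : (Fintype.card E : ℝ) ≠ 0 := by exact_mod_cast Fintype.card_ne_zero
  have hw : ∀ _ : E, 0 ≤ (Fintype.card E : ℝ)⁻¹ := fun _ => by positivity
  have h1 : ∑ _ : E, (Fintype.card E : ℝ)⁻¹ = 1 := by simp [hN]
  have hrot : Γ.rotation (atomic (fun _ => (Fintype.card E : ℝ)⁻¹)
      fun e => signedPt Γ e (Fintype.card E * g e)) = (h : Γ.Chain1) := by
    rw [rotation_atomic hw, hg]
    refine Finset.sum_congr rfl fun e _ => ?_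
    rw [velocity_signedPt, smul_smul, inv_mul_cancel_left₀ hN]
  refine ⟨_, ⟨atomic_mem_probMeasures hw h1, fun f => ?_⟩, hrot⟩
  rw [← pairing_rotation (atomic_mem_probMeasures hw h1), hrot, pairing_d,
    LinearMap.mem_ker.1 h.2, map_zero]

/-! ### Extreme points -/

/-- An extreme point of the closed measures dominates no other closed measure, even up to a
constant factor. -/
theorem Irreducible.eq_of_smul_le [Finite E] {μ ν : Measure Γ.Tangent} (hμ : Γ.Irreducible μ)
    (hν : ν ∈ Γ.closedMeasures) {l : ℝ≥0} (hl : l ≠ 0) (hle : l • ν ≤ μ) : μ = ν := by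
  obtain ⟨hμc, hext⟩ := hμ
  have := hμc.1.1
  have := hν.1.1
  -- shrink the factor below `1`, so that something is left of `μ`
  set k : ℝ≥0 := min l (1 / 2) with hk
  have hk0 : 0 < k := lt_min (pos_iff_ne_zero.2 hl) (by norm_num)
  have hk1 : k < 1 := lt_of_le_of_lt (min_le_right _ _)
    (by rw [← NNReal.coe_lt_coe]; push_cast; norm_num)
  have hkle : k • ν ≤ μ := by
    refine le_trans (fun s => ?_) hle
    simp only [Measure.smul_apply]
    exact mul_le_mul_left (ENNReal.coe_le_coe.2 (min_le_left _ _)) _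
  have hs0 : 0 < 1 - k := tsub_pos_of_lt hk1
  set θ : Measure Γ.Tangent := (1 - k)⁻¹ • (μ - k • ν) with hθ
  have hsum : (1 - k) • θ + k • ν = μ := by
    rw [hθ, smul_smul, mul_inv_cancel₀ hs0.ne', one_smul, Measure.sub_add_cancel_of_le hkle]
  have hint : ∀ F : Γ.Tangent → ℝ, Integrable F μ → Integrable F θ := fun F hF =>
    (hF.mono_measure Measure.sub_le).smul_measure_nnreal
  have hθc : θ ∈ Γ.closedMeasures := by
    refine ⟨⟨⟨?_⟩, ?_⟩, fun f => ?_⟩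
    · rw [hθ, Measure.smul_apply, Measure.sub_apply MeasurableSet.univ hkle, Measure.smul_apply,
        measure_univ, measure_univ]
      change ((1 - k)⁻¹ : ℝ≥0) * ((1 : ℝ≥0∞) - k * 1) = 1
      rw [mul_one, ← ENNReal.coe_one, ← ENNReal.coe_sub, ← ENNReal.coe_mul,
        inv_mul_cancel₀ hs0.ne']
    · have hle' : ∫⁻ z, (Γ.speed z : ℝ≥0∞) ∂(μ - k • ν) ≤ ∫⁻ z, (Γ.speed z : ℝ≥0∞) ∂μ :=
        lintegral_mono' Measure.sub_le le_rfl
      rw [hθ, lintegral_smul_measure]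
      exact ENNReal.mul_ne_top ENNReal.coe_ne_top (ne_top_of_le_ne_top hμc.1.2 hle')
    · clear_value θ
      have h0 := hμc.2 f
      have hi := integrable_cochainFun hμc.1 (Γ.d f)
      rw [← hsum, integral_add_measure (hint _ hi).smul_measure_nnreal
        (integrable_cochainFun hν.1 _).smul_measure_nnreal, integral_smul_nnreal_measure,
        integral_smul_nnreal_measure, hν.2, smul_zero, add_zero] at h0
      exact (smul_eq_zero.1 h0).resolve_left hs0.ne'
  exact (hext hν hθc ⟨k, 1 - k, hk0, hs0, add_tsub_cancel_of_le hk1.le, by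
    rw [add_comm]; exact hsum⟩).symm

end DirGraph

namespace Hamiltonian

open DirGraph

variable {V E : Type*} {Γ : DirGraph V E} (H : Hamiltonian Γ)

/-! ### Hamiltonians and their conjugates -/

theorem continuous_toFun (e : E) : Continuous (H.toFun e) := (H.differentiable e).continuous

theorem exists_mul_abs_sub_le (e : E) (K : ℝ) : ∃ C, ∀ p, K * |p| - C ≤ H.toFun e p := by
  have key : ∀ᶠ p in cocompact ℝ, K * |p| ≤ H.toFun e p := by
    rw [cocompact_eq_atBot_atTop, eventually_sup]
    constructor
    · filter_upwards [(H.superlinear_bot e).eventually_ge_atTop K, eventually_lt_atBot 0] with p hp h0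
      exact (le_div_iff₀ (abs_pos.2 h0.ne)).1 hp
    · filter_upwards [(H.superlinear_top e).eventually_ge_atTop K, eventually_gt_atTop 0] with p hp h0
      exact (le_div_iff₀ (abs_pos.2 h0.ne')).1 hp
  obtain ⟨S, hS, hSsub⟩ := mem_cocompact.1 key
  have hc : Continuous fun p => K * |p| - H.toFun e p := by
    have := H.continuous_toFun e
    fun_prop
  obtain ⟨C, hC⟩ := hS.bddAbove_image hc.continuousOn
  refine ⟨max C 0, fun p => ?_⟩
  by_cases hp : p ∈ S
  · have h1 : K * |p| - H.toFun e p ≤ C := hC (mem_image_of_mem _ hp)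
    linarith [le_max_left C 0]
  · have h1 : K * |p| ≤ H.toFun e p := hSsub hp
    linarith [le_max_right C 0]

theorem tendsto_cocompact (e : E) : Tendsto (H.toFun e) (cocompact ℝ) atTop := by
  obtain ⟨C, hC⟩ := H.exists_mul_abs_sub_le e 1
  refine tendsto_atTop_mono hC ?_
  simp only [one_mul]
  exact tendsto_atTop_add_const_right _ (-C) (tendsto_norm_cocompact_atTop (E := ℝ))

theorem pMin_le (e : E) (r : ℝ) : H.toFun e (H.pMin e) ≤ H.toFun e r :=
  Classical.epsilon_spec (p := fun p => ∀ r, H.toFun e p ≤ H.toFun e r)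
    ((H.continuous_toFun e).exists_forall_le (H.tendsto_cocompact e)) r

theorem strictMono_deriv (e : E) : StrictMono (deriv (H.toFun e)) :=
  strictMonoOn_univ.1 ((H.strictConvex e).strictMonoOn_deriv fun x _ => H.differentiable e x)

theorem deriv_pMin (e : E) : deriv (H.toFun e) (H.pMin e) = 0 :=
  IsLocalMin.deriv_eq_zero (Eventually.of_forall fun r => H.pMin_le e r)

theorem tangent_le (e : E) (p r : ℝ) :
    H.toFun e p + deriv (H.toFun e) p * (r - p) ≤ H.toFun e r := by
  have hc := (H.strictConvex e).convexOn
  rcases lt_trichotomy p r with h | rfl | h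
  · have := hc.deriv_le_slope (mem_univ p) (mem_univ r) h (H.differentiable e p)
    rw [slope_def_field, le_div_iff₀ (sub_pos.2 h)] at this
    linarith
  · simp
  · have := hc.slope_le_deriv (mem_univ r) (mem_univ p) h (H.differentiable e p)
    rw [slope_def_field, div_le_iff₀ (sub_pos.2 h)] at this
    linarith

theorem bddAbove_lagrangian (e : E) (q : ℝ) :
    BddAbove (range fun p => p * q - H.toFun e p) := by
  obtain ⟨C, hC⟩ := H.exists_mul_abs_sub_le e |q|
  refine ⟨C, ?_⟩
  rintro _ ⟨p, rfl⟩
  have h1 := hC p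
  have h2 := le_abs_self (p * q)
  rw [abs_mul, mul_comm] at h2
  change p * q - H.toFun e p ≤ C
  linarith

theorem le_lagrangian (e : E) (p q : ℝ) : p * q - H.toFun e p ≤ H.lagrangian e q :=
  le_ciSup (H.bddAbove_lagrangian e q) p

theorem lagrangian_deriv (e : E) (p : ℝ) :
    H.lagrangian e (deriv (H.toFun e) p) = p * deriv (H.toFun e) p - H.toFun e p := by
  refine le_antisymm (ciSup_le fun r => ?_) (H.le_lagrangian e p _)
  linarith [H.tangent_le e p r]

/-- Equality in Fenchel's inequality. -/
theorem eq_deriv_of_lagrangian_le {e : E} {p q : ℝ} (h : H.lagrangian e q ≤ p * q - H.toFun e p) :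
    q = deriv (H.toFun e) p := by
  have hmax : IsLocalMax (fun r => r * q - H.toFun e r) p :=
    Eventually.of_forall fun r => (H.le_lagrangian e r q).trans h
  have hd : HasDerivAt (fun r => r * q - H.toFun e r) (1 * q - deriv (H.toFun e) p) p :=
    ((hasDerivAt_id p).mul_const q).sub (H.differentiable e p).hasDerivAt
  linarith [hmax.hasDerivAt_eq_zero hd]

theorem continuous_lagrangian (e : E) : Continuous (H.lagrangian e) := by
  have hc : ConvexOn ℝ univ (H.lagrangian e) := by
    refine ⟨convex_univ, fun x _ y _ a b ha hb hab => ciSup_le fun p => ?_⟩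
    have h1 := mul_le_mul_of_nonneg_left (H.le_lagrangian e p x) ha
    have h2 := mul_le_mul_of_nonneg_left (H.le_lagrangian e p y) hb
    simp only [smul_eq_mul]
    calc p * (a * x + b * y) - H.toFun e p
        = a * (p * x - H.toFun e p) + b * (p * y - H.toFun e p) := by
          linear_combination H.toFun e p * hab
      _ ≤ _ := add_le_add h1 h2
  exact continuousOn_univ.1 (hc.continuousOn isOpen_univ)

theorem deriv_rev (e : E) (p : ℝ) :
    deriv (H.toFun (Γ.rev e)) (-p) = -deriv (H.toFun e) p := by
  have h : H.toFun e = fun p => H.toFun (Γ.rev e) (-p) := funext (H.symm e)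
  rw [h, deriv_comp_neg, neg_neg]

/-! ### The increasing branch of the inverse -/

theorem exists_eq_of_pMin_le {e : E} {a : ℝ} (ha : H.toFun e (H.pMin e) ≤ a) :
    ∃ p ∈ Ici (H.pMin e), H.toFun e p = a := by
  have htop : Tendsto (H.toFun e) atTop atTop :=
    (H.tendsto_cocompact e).mono_left atTop_le_cocompact
  obtain ⟨r, hr, har⟩ :=
    ((eventually_ge_atTop (H.pMin e)).and (htop.eventually_ge_atTop a)).exists
  obtain ⟨p, hp, hpa⟩ := intermediate_value_Icc hr (H.continuous_toFun e).continuousOn ⟨ha, har⟩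
  exact ⟨p, hp.1, hpa⟩

theorem toFun_sigma {e : E} {a : ℝ} (ha : H.toFun e (H.pMin e) ≤ a) :
    H.toFun e (H.sigma e a) = a :=
  Function.invFunOn_eq (H.exists_eq_of_pMin_le ha)

theorem pMin_le_sigma {e : E} {a : ℝ} (ha : H.toFun e (H.pMin e) ≤ a) :
    H.pMin e ≤ H.sigma e a :=
  Function.invFunOn_mem (H.exists_eq_of_pMin_le ha)

theorem strictMonoOn_Ici_pMin (e : E) : StrictMonoOn (H.toFun e) (Ici (H.pMin e)) := by
  refine strictMonoOn_of_deriv_pos (convex_Ici _) (H.continuous_toFun e).continuousOn fun p hp => ?_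
  rw [interior_Ici, mem_Ioi] at hp
  rw [← H.deriv_pMin e]
  exact H.strictMono_deriv e hp

theorem sigma_eq {e : E} {a p : ℝ} (hp : H.toFun e p = a) (hd : 0 ≤ deriv (H.toFun e) p) :
    H.sigma e a = p := by
  have ha : H.toFun e (H.pMin e) ≤ a := hp ▸ H.pMin_le e p
  rw [← H.deriv_pMin e, (H.strictMono_deriv e).le_iff_le] at hd
  exact (H.strictMonoOn_Ici_pMin e).injOn (H.pMin_le_sigma ha) hd ((H.toFun_sigma ha).trans hp.symm)

theorem deriv_sigma_nonneg {e : E} {a : ℝ} (ha : H.toFun e (H.pMin e) ≤ a) :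
    0 ≤ deriv (H.toFun e) (H.sigma e a) := by
  rw [← H.deriv_pMin e, (H.strictMono_deriv e).le_iff_le]
  exact H.pMin_le_sigma ha

/-- A zero speed at level `a` means that `a` is the minimum of `H(e, ·)`, hence of `H(-e, ·)`; then
`σ(e, a)` and `σ(-e, a)` are the two opposite minimizers. -/
theorem sigma_rev_of_deriv_eq_zero {e : E} {a : ℝ} (ha : H.toFun e (H.pMin e) ≤ a)
    (hd : deriv (H.toFun e) (H.sigma e a) = 0) : H.sigma (Γ.rev e) a = -H.sigma e a := by
  refine H.sigma_eq ?_ ?_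
  · rw [← H.symm, H.toFun_sigma ha]
  · rw [H.deriv_rev, hd, neg_zero]

/-! ### The action -/

@[simp] theorem modLagrangian_pt (ω : Γ.cochain1) (e : E) (q : ℝ≥0) :
    H.modLagrangian ω (Γ.pt e q) = H.lagrangian e q - q * (ω : E → ℝ) e := rfl

theorem modLagrangian_signedPt (ω : Γ.cochain1) (e : E) (r : ℝ) :
    H.modLagrangian ω (signedPt Γ e r) = H.lagrangian e r - r * (ω : E → ℝ) e := by
  unfold signedPt
  split_ifs with h
  · rw [modLagrangian_pt, Real.coe_toNNReal _ h]
  · rw [modLagrangian_pt, Real.coe_toNNReal _ (by linarith), H.lagrangian_rev, ω.2 e]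
    ring

theorem continuous_modLagrangian (ω : Γ.cochain1) : Continuous (H.modLagrangian ω) :=
  continuous_lift _ fun e => by
    have := H.continuous_lagrangian e
    fun_prop

theorem modLagrangian_add (ω η : Γ.cochain1) (z : Γ.Tangent) :
    H.modLagrangian (ω + η) z = H.modLagrangian ω z - Γ.cochainFun η z := by
  obtain ⟨e, q, rfl⟩ := exists_pt_eq z
  simp only [modLagrangian_pt, cochainFun_pt, Submodule.coe_add, Pi.add_apply]
  ring

/-- Fenchel's inequality for a cochain `η` on which `H^ω` is at most `a`. -/
theorem cochainFun_sub_le {ω η : Γ.cochain1} {a : ℝ}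
    (h : ∀ e, H.toFun e ((η : E → ℝ) e + (ω : E → ℝ) e) ≤ a) (z : Γ.Tangent) :
    Γ.cochainFun η z - a ≤ H.modLagrangian ω z := by
  obtain ⟨e, q, rfl⟩ := exists_pt_eq z
  have h1 := H.le_lagrangian e ((η : E → ℝ) e + (ω : E → ℝ) e) q
  have h2 := h e
  rw [modLagrangian_pt, cochainFun_pt]
  linarith

theorem action_of_integrable {ω : Γ.cochain1} {μ : Measure Γ.Tangent}
    (h : Integrable (H.modLagrangian ω) μ) :
    H.action ω μ = ((∫ z, H.modLagrangian ω z ∂μ : ℝ) : EReal) := by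
  have h1 : ∫⁻ z, ENNReal.ofReal (H.modLagrangian ω z) ∂μ ≠ ⊤ := h.lintegral_lt_top.ne
  have h2 : ∫⁻ z, ENNReal.ofReal (-H.modLagrangian ω z) ∂μ ≠ ⊤ := h.neg.lintegral_lt_top.ne
  rw [action, integral_eq_lintegral_pos_part_sub_lintegral_neg_part h, EReal.coe_sub]
  lift ∫⁻ z, ENNReal.ofReal (H.modLagrangian ω z) ∂μ to ℝ≥0 using h1 with x
  lift ∫⁻ z, ENNReal.ofReal (-H.modLagrangian ω z) ∂μ to ℝ≥0 using h2 with y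
  rfl

theorem action_atomic {ι : Type*} [Fintype ι] {w : ι → ℝ} (hw : ∀ i, 0 ≤ w i)
    (z : ι → Γ.Tangent) (ω : Γ.cochain1) :
    H.action ω (atomic w z) = ((∑ i, w i * H.modLagrangian ω (z i) : ℝ) : EReal) := by
  rw [H.action_of_integrable (integrable_atomic _), integral_atomic hw]

section FiniteEdges

variable [Finite E]

theorem action_of_not_integrable {ω : Γ.cochain1} {μ : Measure Γ.Tangent}
    (hμ : μ ∈ Γ.probMeasures) (h : ¬ Integrable (H.modLagrangian ω) μ) : H.action ω μ = ⊤ := by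
  have := hμ.1
  have := Fintype.ofFinite E
  obtain ⟨a, ha⟩ : ∃ a, ∀ e, H.toFun e (((0 : Γ.cochain1) : E → ℝ) e + (ω : E → ℝ) e) ≤ a := by
    obtain ⟨a, ha⟩ := (finite_range fun e =>
      H.toFun e (((0 : Γ.cochain1) : E → ℝ) e + (ω : E → ℝ) e)).bddAbove
    exact ⟨a, fun e => ha (mem_range_self e)⟩
  have hneg : ∫⁻ z, ENNReal.ofReal (-H.modLagrangian ω z) ∂μ ≠ ⊤ := by
    have hle : ∀ z, ENNReal.ofReal (-H.modLagrangian ω z) ≤ ENNReal.ofReal a := fun z => by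
      refine ENNReal.ofReal_le_ofReal ?_
      have h1 := H.cochainFun_sub_le ha z
      obtain ⟨e, q, rfl⟩ := exists_pt_eq z
      simp only [cochainFun_pt, ZeroMemClass.coe_zero, Pi.zero_apply, mul_zero] at h1
      linarith
    refine ne_top_of_le_ne_top ?_ (lintegral_mono hle)
    simp
  have hpos : ∫⁻ z, ENNReal.ofReal (H.modLagrangian ω z) ∂μ = ⊤ := by
    by_contra hne
    refine h ⟨(H.continuous_modLagrangian ω).aestronglyMeasurable, ?_⟩
    rw [hasFiniteIntegral_iff_enorm]
    have he : ∀ z, ‖H.modLagrangian ω z‖ₑ =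
        ENNReal.ofReal (H.modLagrangian ω z) + ENNReal.ofReal (-H.modLagrangian ω z) := fun z => by
      rw [Real.enorm_eq_ofReal_abs]
      rcases le_total 0 (H.modLagrangian ω z) with h0 | h0
      · rw [abs_of_nonneg h0, ENNReal.ofReal_of_nonpos (neg_nonpos.2 h0), add_zero]
      · rw [abs_of_nonpos h0, ENNReal.ofReal_of_nonpos h0, zero_add]
    simp_rw [he]
    rw [lintegral_add_left (H.continuous_modLagrangian ω).measurable.ennreal_ofReal]
    exact ENNReal.add_lt_top.2 ⟨lt_top_iff_ne_top.2 hne, lt_top_iff_ne_top.2 hneg⟩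
  rw [action, hpos, EReal.coe_ennreal_top]
  exact EReal.top_sub (EReal.coe_ennreal_eq_top_iff.not.2 hneg)

/-- Changing the cochain by `η` changes the action by the integral of `η`, even when the action is
infinite. -/
theorem action_add {ω η : Γ.cochain1} {μ : Measure Γ.Tangent} (hμ : μ ∈ Γ.probMeasures) :
    H.action (ω + η) μ = H.action ω μ - ((∫ z, Γ.cochainFun η z ∂μ : ℝ) : EReal) := by
  have hη := integrable_cochainFun hμ η
  have heq : H.modLagrangian (ω + η) = fun z => H.modLagrangian ω z - Γ.cochainFun η z :=
    funext (H.modLagrangian_add ω η)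
  by_cases h : Integrable (H.modLagrangian ω) μ
  · rw [H.action_of_integrable (heq ▸ h.sub hη), H.action_of_integrable h, ← EReal.coe_sub,
      ← integral_sub h hη, heq]
  · have h' : ¬ Integrable (H.modLagrangian (ω + η)) μ := fun h1 => h <| by
      refine (h1.add hη).congr (Eventually.of_forall fun z => ?_)
      simp [heq]
    rw [H.action_of_not_integrable hμ h, H.action_of_not_integrable hμ h', EReal.top_sub_coe]

theorem action_add_d {ω : Γ.cochain1} {f : V → ℝ} {μ : Measure Γ.Tangent}
    (hμ : μ ∈ Γ.closedMeasures) : H.action (ω + Γ.d f) μ = H.action ω μ := by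
  rw [H.action_add hμ.1, hμ.2, EReal.coe_zero, sub_zero]

theorem action_eq_of_cohClass_eq {ω ω' : Γ.cochain1} (h : Γ.cohClass ω' = Γ.cohClass ω)
    {μ : Measure Γ.Tangent} (hμ : μ ∈ Γ.closedMeasures) : H.action ω' μ = H.action ω μ := by
  obtain ⟨f, hf⟩ := (Submodule.Quotient.eq _).1 h
  rw [← H.action_add_d hμ (ω := ω) (f := f), hf, add_sub_cancel]

/-- The action of a closed measure is bounded below by any level with a subsolution. -/
theorem neg_le_action {ω : Γ.cochain1} {a : ℝ} {u : V → ℝ}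
    (h : ∀ e, H.toFun e ((Γ.d u : E → ℝ) e + (ω : E → ℝ) e) ≤ a) {μ : Measure Γ.Tangent}
    (hμ : μ ∈ Γ.closedMeasures) : ((-a : ℝ) : EReal) ≤ H.action ω μ := by
  have := hμ.1.1
  by_cases hi : Integrable (H.modLagrangian ω) μ
  · rw [H.action_of_integrable hi, EReal.coe_le_coe_iff]
    have hu := integrable_cochainFun hμ.1 (Γ.d u)
    calc -a = ∫ z, (Γ.cochainFun (Γ.d u) z - a) ∂μ := by
          rw [integral_sub hu (integrable_const a), hμ.2]
          simp
      _ ≤ _ := integral_mono (hu.sub (integrable_const a)) hi (H.cochainFun_sub_le h)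
  · rw [H.action_of_not_integrable hμ.1 hi]
    exact le_top

end FiniteEdges

/-! ### The critical value as a minimax -/

/-- The function `u ↦ maxₑ H^ω(e, du(e))` attains its minimum: it is a coercive function of `du`,
which runs over a finite-dimensional space. -/
theorem exists_minimax [Finite E] [Nonempty E] (ω : Γ.cochain1) :
    ∃ (u : V → ℝ) (a : ℝ), (∀ e, H.toFun e ((Γ.d u : E → ℝ) e + (ω : E → ℝ) e) ≤ a) ∧
      ∀ v : V → ℝ, ∃ e, a ≤ H.toFun e ((Γ.d v : E → ℝ) e + (ω : E → ℝ) e) := by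
  have := Fintype.ofFinite E
  let S : Submodule ℝ (E → ℝ) := LinearMap.range (Γ.cochain1.subtype.comp Γ.d)
  have hne : (Finset.univ : Finset E).Nonempty := Finset.univ_nonempty
  let G : S → ℝ := fun η => Finset.univ.sup' hne fun e => H.toFun e ((η : E → ℝ) e + (ω : E → ℝ) e)
  have hG : Continuous G := by
    refine Continuous.finset_sup'_apply hne fun e _ => (H.continuous_toFun e).comp ?_
    exact ((continuous_apply e).comp continuous_subtype_val).add continuous_const
  choose C hC using fun e => H.exists_mul_abs_sub_le e 1
  have hlow : ∀ η : S, ‖η‖ - ∑ e, (|(ω : E → ℝ) e| + |C e|) ≤ G η := fun η => by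
    have hGe : ∀ e, |(η : E → ℝ) e| - ∑ e, (|(ω : E → ℝ) e| + |C e|) ≤ G η := fun e => by
      have h1 := hC e ((η : E → ℝ) e + (ω : E → ℝ) e)
      have h2 : H.toFun e ((η : E → ℝ) e + (ω : E → ℝ) e) ≤ G η :=
        Finset.le_sup' (fun e => H.toFun e ((η : E → ℝ) e + (ω : E → ℝ) e)) (Finset.mem_univ e)
      have h3 : |(ω : E → ℝ) e| + |C e| ≤ ∑ e, (|(ω : E → ℝ) e| + |C e|) :=
        Finset.single_le_sum (f := fun e => |(ω : E → ℝ) e| + |C e|)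
          (fun _ _ => by positivity) (Finset.mem_univ e)
      have h4 := abs_sub_abs_le_abs_sub ((η : E → ℝ) e) (-(ω : E → ℝ) e)
      rw [abs_neg, sub_neg_eq_add] at h4
      linarith [le_abs_self (C e)]
    rw [sub_le_iff_le_add, Submodule.coe_norm, pi_norm_le_iff_of_nonempty]
    intro e
    rw [Real.norm_eq_abs]
    linarith [hGe e]
  have hlim : Tendsto G (cocompact S) atTop :=
    tendsto_atTop_mono hlow
      (tendsto_atTop_add_const_right _ _ (tendsto_norm_cocompact_atTop (E := S)))
  obtain ⟨⟨_, u, rfl⟩, hu⟩ := hG.exists_forall_le hlim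
  refine ⟨u, G ⟨_, u, rfl⟩, fun e => Finset.le_sup' (fun e => H.toFun e
    ((Γ.d u : E → ℝ) e + (ω : E → ℝ) e)) (Finset.mem_univ e), fun v => ?_⟩
  obtain ⟨e, -, he⟩ := Finset.exists_mem_eq_sup' hne fun e =>
    H.toFun e ((Γ.d v : E → ℝ) e + (ω : E → ℝ) e)
  exact ⟨e, (hu ⟨_, v, rfl⟩).trans he.le⟩

/-- First-order optimality at the minimax: zero is a convex combination of the differentials
`f ↦ H'(e, ·) df(e)` over the edges where the maximum is attained. Otherwise a hyperplane separates
it from their convex hull, which is a direction in which all of these edges improve. -/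
theorem exists_multipliers [Finite V] [Finite E] {ω : Γ.cochain1} {u : V → ℝ} {a : ℝ}
    (hu : ∀ e, H.toFun e ((Γ.d u : E → ℝ) e + (ω : E → ℝ) e) ≤ a)
    (hmin : ∀ v : V → ℝ, ∃ e, a ≤ H.toFun e ((Γ.d v : E → ℝ) e + (ω : E → ℝ) e)) :
    ∃ (ι : Type) (_ : Fintype ι) (w : ι → ℝ) (g : ι → E), (∀ i, 0 ≤ w i) ∧ ∑ i, w i = 1 ∧
      (∀ i, H.toFun (g i) ((Γ.d u : E → ℝ) (g i) + (ω : E → ℝ) (g i)) = a) ∧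
      ∀ f : V → ℝ, ∑ i, w i * (deriv (H.toFun (g i))
        ((Γ.d u : E → ℝ) (g i) + (ω : E → ℝ) (g i)) * (Γ.d f : E → ℝ) (g i)) = 0 := by
  classical
  have := Fintype.ofFinite V
  set p : E → ℝ := fun e => (Γ.d u : E → ℝ) e + (ω : E → ℝ) e with hp
  set A : Set E := {e | H.toFun e (p e) = a}
  let v : E → V → ℝ := fun e =>
    deriv (H.toFun e) (p e) • (Pi.single (Γ.t e) 1 - Pi.single (Γ.o e) 1)
  have h0 : (0 : V → ℝ) ∈ convexHull ℝ (v '' A) := by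
    by_contra h0
    obtain ⟨φ, s, hs, hs'⟩ := geometric_hahn_banach_closed_point
      (convex_convexHull ℝ (v '' A)) ((toFinite (v '' A)).isClosed_convexHull ℝ) h0
    rw [map_zero] at hs'
    set f : V → ℝ := fun x => φ (Pi.single x 1)
    have hneg : ∀ e ∈ A, deriv (H.toFun e) (p e) * (Γ.d f : E → ℝ) e < 0 := fun e he => by
      have h1 := hs _ (subset_convexHull ℝ _ (mem_image_of_mem v he))
      simp only [v, map_smul, map_sub, smul_eq_mul] at h1
      exact h1.trans hs'
    have hev : ∀ e, ∀ᶠ r in nhdsWithin (0 : ℝ) (Ioi 0),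
        H.toFun e (p e + r * (Γ.d f : E → ℝ) e) < a := fun e => by
      have hd : HasDerivAt (fun r : ℝ => H.toFun e (p e + r * (Γ.d f : E → ℝ) e))
          (deriv (H.toFun e) (p e) * (1 * (Γ.d f : E → ℝ) e)) 0 := by
        have h2 : HasDerivAt (fun r : ℝ => p e + r * (Γ.d f : E → ℝ) e)
            (1 * (Γ.d f : E → ℝ) e) 0 := ((hasDerivAt_id (0 : ℝ)).mul_const _).const_add _
        refine HasDerivAt.comp (h₂ := H.toFun e) (0 : ℝ) ?_ h2
        simpa using (H.differentiable e (p e)).hasDerivAt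
      by_cases he : e ∈ A
      · have hneg' := hneg e he
        rw [← one_mul ((Γ.d f : E → ℝ) e)] at hneg'
        have h3 := (hasDerivWithinAt_iff_tendsto_slope' (s := Ioi (0 : ℝ)) (by simp)).1
          hd.hasDerivWithinAt
        filter_upwards [h3.eventually_lt_const hneg', self_mem_nhdsWithin] with r hr hr0
        rw [slope_def_field, zero_mul, add_zero, sub_zero, show H.toFun e (p e) = a from he] at hr
        have hr0' : 0 < r := hr0
        have := (div_lt_iff₀ hr0').1 hr
        linarith
      · have hlt : H.toFun e (p e) < a := lt_of_le_of_ne (hu e) he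
        have h4 := hd.continuousAt.eventually_lt (continuousAt_const (y := a)) (by simpa using hlt)
        exact h4.filter_mono nhdsWithin_le_nhds
    obtain ⟨r, hr⟩ := (eventually_all.2 hev).exists
    obtain ⟨e, he⟩ := hmin (u + r • f)
    refine absurd (hr e) (not_lt.2 (he.trans (le_of_eq ?_)))
    simp only [hp, map_add, map_smul, Submodule.coe_add, Submodule.coe_smul, Pi.add_apply,
      Pi.smul_apply, smul_eq_mul]
    congr 1
    ring
  obtain ⟨ι, _, w, z, hw, h1, hz, hsum⟩ := mem_convexHull_iff_exists_fintype.1 h0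
  choose g hgA hg using hz
  refine ⟨ι, inferInstance, w, g, hw, h1, hgA, fun f => ?_⟩
  have hf := congrArg (fun x : V → ℝ => f ⬝ᵥ x) hsum
  simp only [dotProduct_zero] at hf
  rw [dotProduct_sum] at hf
  rw [← hf]
  refine Finset.sum_congr rfl fun i _ => ?_
  rw [← hg i]
  simp only [v, dotProduct_smul, dotProduct_sub, dotProduct_single, mul_one, smul_eq_mul, d_apply,
    hp]

/-- The multipliers at the minimax are the weights of a closed measure that realizes the lower
bound for the action given by a subsolution. -/
theorem exists_minimizer [Finite V] [Finite E] [Nonempty E] (ω : Γ.cochain1) :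
    ∃ (u : V → ℝ) (a : ℝ), (∀ e, H.toFun e ((Γ.d u : E → ℝ) e + (ω : E → ℝ) e) ≤ a) ∧
      (∀ v : V → ℝ, ∃ e, a ≤ H.toFun e ((Γ.d v : E → ℝ) e + (ω : E → ℝ) e)) ∧
      ∃ μ ∈ Γ.closedMeasures, H.action ω μ = ((-a : ℝ) : EReal) := by
  obtain ⟨u, a, hu, hmin⟩ := H.exists_minimax ω
  obtain ⟨ι, _, w, g, hw, h1, hg, hd⟩ := H.exists_multipliers hu hmin
  refine ⟨u, a, hu, hmin, atomic w fun i => signedPt Γ (g i) (deriv (H.toFun (g i))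
    ((Γ.d u : E → ℝ) (g i) + (ω : E → ℝ) (g i))), atomic_mem_closedMeasures hw h1 fun f => ?_, ?_⟩
  · simp only [cochainFun_signedPt]
    exact hd f
  · rw [H.action_atomic hw, EReal.coe_eq_coe_iff]
    have hterm : ∀ i, w i * H.modLagrangian ω (signedPt Γ (g i) (deriv (H.toFun (g i))
        ((Γ.d u : E → ℝ) (g i) + (ω : E → ℝ) (g i)))) =
        w i * (deriv (H.toFun (g i)) ((Γ.d u : E → ℝ) (g i) + (ω : E → ℝ) (g i)) *
          (Γ.d u : E → ℝ) (g i)) - w i * a := fun i => by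
      rw [modLagrangian_signedPt, lagrangian_deriv, hg i]
      ring
    rw [Finset.sum_congr rfl fun i _ => hterm i, Finset.sum_sub_distrib, hd, ← Finset.sum_mul, h1]
    ring

/-! ### Mather's function and the critical value -/

theorem isLeast_subsolutionLevels {ω : Γ.cochain1} {u : V → ℝ} {a : ℝ}
    (hu : ∀ e, H.toFun e ((Γ.d u : E → ℝ) e + (ω : E → ℝ) e) ≤ a)
    (hmin : ∀ v : V → ℝ, ∃ e, a ≤ H.toFun e ((Γ.d v : E → ℝ) e + (ω : E → ℝ) e)) :
    IsLeast (H.subsolutionLevels ω) a := by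
  refine ⟨⟨u, fun _ e _ => hu e⟩, ?_⟩
  rintro b ⟨v, hv⟩
  obtain ⟨e, he⟩ := hmin v
  exact he.trans (hv _ e rfl)

theorem action_eq_action_zero [Fintype E] (ω : Γ.cochain1) {μ : Measure Γ.Tangent}
    (hμ : μ ∈ Γ.closedMeasures) {h : Γ.H1} (hh : Γ.rotation μ = (h : Γ.Chain1)) :
    H.action ω μ = H.action 0 μ - ((Γ.cohPairing (Γ.cohClass ω) h : ℝ) : EReal) := by
  have h1 := H.action_add (ω := 0) (η := ω) hμ.1
  rw [zero_add, ← pairing_rotation hμ.1, hh] at h1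
  exact h1

/-- Mather's `α` is minus the minimal action: minimizing first over the measures of a given
rotation vector gives `β`, and `α` is conjugate to it. -/
theorem alpha_eq [Fintype E] [Nonempty E] {ω : Γ.cochain1} {a : ℝ}
    (hle : ∀ μ ∈ Γ.closedMeasures, ((-a : ℝ) : EReal) ≤ H.action ω μ)
    (hex : ∃ μ ∈ Γ.closedMeasures, H.action ω μ = ((-a : ℝ) : EReal)) :
    H.alpha (Γ.cohClass ω) = a := by
  have hlow : ∀ (h : Γ.H1) (μ : Measure Γ.Tangent), μ ∈ Γ.closedMeasures →
      Γ.rotation μ = (h : Γ.Chain1) →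
      ((Γ.cohPairing (Γ.cohClass ω) h - a : ℝ) : EReal) ≤ H.action 0 μ := fun h μ hμ hh => by
    have h1 := hle μ hμ
    rw [H.action_eq_action_zero ω hμ hh] at h1
    have h2 := EReal.add_le_of_le_sub h1
    rw [← EReal.coe_add] at h2
    rwa [show Γ.cohPairing (Γ.cohClass ω) h - a = -a + Γ.cohPairing (Γ.cohClass ω) h by ring]
  -- the infimum that defines `β` is a real number, so that `β` is not a junk value
  have hbeta : ∀ h : Γ.H1, ((H.beta h : ℝ) : EReal) =
      sInf (H.action 0 '' {μ | μ ∈ Γ.closedMeasures ∧ Γ.rotation μ = (h : Γ.Chain1)}) := fun h => by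
    obtain ⟨z, hz, hrot⟩ := exists_atomic_rotation_eq h
    refine EReal.coe_toReal (ne_top_of_le_ne_top ?_ (sInf_le ⟨_, ⟨hz, hrot⟩, rfl⟩))
      (ne_bot_of_le_ne_bot (EReal.coe_ne_bot (Γ.cohPairing (Γ.cohClass ω) h - a))
        (le_sInf ?_))
    · rw [H.action_atomic fun _ => by positivity]
      exact EReal.coe_ne_top _
    · rintro _ ⟨μ, ⟨hμ, hh⟩, rfl⟩
      exact hlow h μ hμ hh
  have hub : ∀ h : Γ.H1, Γ.cohPairing (Γ.cohClass ω) h - H.beta h ≤ a := fun h => by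
    have h1 : ((Γ.cohPairing (Γ.cohClass ω) h - a : ℝ) : EReal) ≤ (H.beta h : ℝ) := by
      rw [hbeta]
      refine le_sInf ?_
      rintro _ ⟨μ, ⟨hμ, hh⟩, rfl⟩
      exact hlow h μ hμ hh
    linarith [EReal.coe_le_coe_iff.1 h1]
  obtain ⟨μ, hμ, hact⟩ := hex
  refine le_antisymm (ciSup_le hub) ?_
  let h : Γ.H1 := ⟨Γ.rotation μ, rotation_mem_H1 hμ⟩
  refine le_trans ?_ (le_ciSup (f := fun h : Γ.H1 => Γ.cohPairing (Γ.cohClass ω) h - H.beta h)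
    ⟨a, forall_mem_range.2 hub⟩ h)
  have h0 : H.action 0 μ = ((Γ.cohPairing (Γ.cohClass ω) h - a : ℝ) : EReal) := by
    have h1 := H.action_add (ω := ω) (η := -ω) hμ.1
    have h2 := pairing_rotation hμ.1 (-ω)
    rw [add_neg_cancel, hact, ← h2, ← EReal.coe_sub] at h1
    rw [h1, EReal.coe_eq_coe_iff, map_neg, LinearMap.neg_apply]
    change -a - -(Γ.cohPairing (Γ.cohClass ω) h) = _
    ring
  have h1 : ((H.beta h : ℝ) : EReal) ≤ ((Γ.cohPairing (Γ.cohClass ω) h - a : ℝ) : EReal) := by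
    rw [hbeta, ← h0]
    exact sInf_le ⟨μ, ⟨hμ, rfl⟩, rfl⟩
  change a ≤ Γ.cohPairing (Γ.cohClass ω) h - H.beta h
  linarith [EReal.coe_le_coe_iff.1 h1]

end Hamiltonian

namespace DirGraph

variable {V E : Type*} {Γ : DirGraph V E}

/-! ### Circuits and their occupation measures -/

theorem EdgePath.sum_d (ζ : Γ.EdgePath) (f : V → ℝ) :
    ∑ i, (Γ.d f : E → ℝ) (ζ.edge i) = f ζ.terminus - f ζ.origin := by
  simp only [d_apply, Finset.sum_sub_distrib]
  rw [Fin.sum_univ_castSucc, Fin.sum_univ_succ (fun i => f (Γ.o (ζ.edge i)))]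
  simp only [ζ.concat, EdgePath.terminus, EdgePath.origin]
  ring

/-- A nonempty set of edges in which every edge can be continued contains a circuit: follow a
walk and cut out a shortest piece between two visits of the same vertex. -/
theorem exists_circuit_of_successor [Finite V] {A : Set E} (hne : A.Nonempty)
    (hA : ∀ e ∈ A, ∃ f ∈ A, Γ.o f = Γ.t e) :
    ∃ ζ : Γ.EdgePath, ζ.IsCircuit ∧ ∀ i, ζ.edge i ∈ A := by
  classical
  obtain ⟨e₀, he₀⟩ := hne
  choose! next hnext hnext' using hA
  let s : ℕ → E := fun k => next^[k] e₀
  have hs : ∀ k, s (k + 1) = next (s k) := fun k => Function.iterate_succ_apply' next k e₀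
  have hsA : ∀ k, s k ∈ A := fun k => by
    induction k with
    | zero => exact he₀
    | succ k ih => rw [hs]; exact hnext _ ih
  have hcat : ∀ k, Γ.o (s (k + 1)) = Γ.t (s k) := fun k => by rw [hs]; exact hnext' _ (hsA k)
  have hrep : ∃ n i, Γ.t (s i) = Γ.t (s (i + n + 1)) := by
    obtain ⟨i, j, hij, h⟩ := Finite.exists_ne_map_eq_of_infinite fun k => Γ.t (s k)
    rcases hij.lt_or_gt with hlt | hlt
    · exact ⟨j - i - 1, i, by rw [show i + (j - i - 1) + 1 = j by omega]; exact h⟩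
    · exact ⟨i - j - 1, j, by rw [show j + (i - j - 1) + 1 = i by omega]; exact h.symm⟩
  obtain ⟨i, hi⟩ := Nat.find_spec hrep
  set n := Nat.find hrep
  refine ⟨⟨n, fun k => s (i + 1 + k), fun k => (hcat _).symm⟩, ⟨?_, fun k l hkl => ?_⟩,
    fun k => hsA _⟩
  · change Γ.o (s (i + 1 + 0)) = Γ.t (s (i + 1 + n))
    rw [add_zero, hcat, hi]
    congr 2
    omega
  · have key : ∀ k l : Fin (n + 1), k < l → Γ.t (s (i + 1 + k)) ≠ Γ.t (s (i + 1 + l)) := by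
      intro k l hlt h
      have hkl' : (k : ℕ) < l := hlt
      have hl := l.2
      refine Nat.find_min hrep (m := l - k - 1) (by omega) ⟨i + 1 + k, ?_⟩
      rw [h]
      congr 2
      omega
    rcases lt_trichotomy k l with h | h | h
    · exact absurd hkl (key k l h)
    · exact h
    · exact absurd hkl.symm (key l k h)

theorem ParamPath.totalTime_pos (ξ : Γ.ParamPath) : 0 < ξ.totalTime :=
  Finset.sum_pos (fun i _ => ξ.time_pos i) Finset.univ_nonempty

theorem ParamPath.weight_nonneg (ξ : Γ.ParamPath) (i : Fin (ξ.n + 1)) :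
    0 ≤ ξ.time i / ξ.totalTime :=
  div_nonneg (ξ.time_pos i).le ξ.totalTime_pos.le

theorem ParamPath.sum_weight (ξ : Γ.ParamPath) : ∑ i, ξ.time i / ξ.totalTime = 1 := by
  rw [← Finset.sum_div]
  exact div_self ξ.totalTime_pos.ne'

theorem ParamPath.occupation_eq_atomic (ξ : Γ.ParamPath) :
    ξ.occupation = atomic (fun i => ξ.time i / ξ.totalTime)
      fun i => Γ.pt (ξ.edge i) (ξ.speed i) := rfl

theorem ParamPath.weight_mul_speed (ξ : Γ.ParamPath) {i : Fin (ξ.n + 1)} (hi : ξ.speed i ≠ 0) :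
    ξ.time i / ξ.totalTime * ξ.speed i = 1 / ξ.totalTime := by
  have h : (ξ.speed i : ℝ) ≠ 0 := by exact_mod_cast hi
  rw [ξ.time_eq i hi, div_mul_eq_mul_div, one_div_mul_cancel h]

/-- Floating amounts to resting at a vertex, and a circuit visits each of its vertices once. -/
theorem ParamPath.moving_or_still (ξ : Γ.ParamPath) (hξ : ξ.toEdgePath.IsCircuit) :
    (∀ i, ξ.speed i ≠ 0) ∨ ∀ i, ξ.speed i = 0 := by
  classical
  by_cases hstill : ∀ i, ξ.speed i = 0
  · exact Or.inr hstill
  left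
  push Not at hstill
  obtain ⟨i₀, hi₀⟩ := hstill
  have hdown : ∀ i : Fin ξ.n, ξ.speed i.succ ≠ 0 → ξ.speed i.castSucc ≠ 0 := by
    intro i hi
    by_cases hex : ∃ k, k < i.succ ∧ ξ.speed k ≠ 0
    · obtain ⟨j, hj, hmax⟩ := Finset.exists_max_image
        (Finset.univ.filter fun k => k < i.succ ∧ ξ.speed k ≠ 0) id
        (by obtain ⟨k, hk⟩ := hex; exact ⟨k, by simpa using hk⟩)
      simp only [Finset.mem_filter, Finset.mem_univ, true_and, id] at hj hmax
      have h1 := ξ.resume _ _ hj.1 hi hj.2 fun k hjk hki => by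
        by_contra hk
        exact absurd (hmax k ⟨hki, hk⟩) (not_le.2 hjk)
      rw [← ξ.concat i] at h1
      rw [hξ.2 _ _ h1]
      exact hj.2
    · push Not at hex
      have h1 := ξ.start _ hi hex
      rw [← ξ.concat i, hξ.1] at h1
      exact absurd (hξ.2 _ _ h1) (Fin.castSucc_lt_last i).ne
  have hlast : ξ.speed (Fin.last ξ.n) ≠ 0 := by
    obtain ⟨j, hj, hmax⟩ := Finset.exists_max_image
      (Finset.univ.filter fun k => ξ.speed k ≠ 0) id ⟨i₀, by simpa using hi₀⟩
    simp only [Finset.mem_filter, Finset.mem_univ, true_and, id] at hj hmax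
    have h1 := ξ.arrive j hj fun k hjk => by
      by_contra hk
      exact absurd (hmax k hk) (not_le.2 hjk)
    rw [← hξ.2 _ _ h1]
    exact hj
  exact fun i => Fin.reverseInduction (motive := fun i => ξ.speed i ≠ 0) hlast hdown i

/-- The parametrization of a path by given positive speeds. -/
noncomputable def EdgePath.moving (ζ : Γ.EdgePath) (q : Fin (ζ.n + 1) → ℝ≥0) (hq : ∀ i, q i ≠ 0) :
    Γ.ParamPath where
  toEdgePath := ζ
  speed := q
  time i := 1 / q i
  time_pos i := one_div_pos.2 (NNReal.coe_pos.2 (pos_iff_ne_zero.2 (hq i)))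
  time_eq _ _ := rfl
  closed_of_still h := absurd (h 0) (hq 0)
  float i h := absurd h (hq _)
  resume i j hji _ _ h := by
    obtain ⟨k, rfl⟩ : ∃ k : Fin ζ.n, k.succ = i :=
      Fin.exists_succ_eq.2 (Fin.ne_zero_of_lt hji)
    have hjk : j = k.castSucc := by
      by_contra hne
      exact hq _ (h k.castSucc (lt_of_le_of_ne (Fin.le_castSucc_iff.2 hji) hne)
        Fin.castSucc_lt_succ)
    rw [hjk]
    exact (ζ.concat k).symm
  start i _ h := by
    have hi : i = 0 := by
      by_contra hne
      exact hq 0 (h 0 (Fin.pos_iff_ne_zero.2 hne))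
    rw [hi]
    rfl
  arrive j _ h := by
    have hj : j = Fin.last ζ.n := by
      by_contra hne
      exact hq _ (h _ (Fin.lt_last_iff_ne_last.2 hne))
    rw [hj]
    rfl

/-- The parametrized path that floats once back and forth along an edge. -/
def floatingPath (Γ : DirGraph V E) (e : E) : Γ.ParamPath where
  n := 1
  edge := ![e, Γ.rev e]
  concat i := by
    fin_cases i
    rfl
  speed _ := 0
  time _ := 1
  time_pos _ := one_pos
  time_eq _ h := absurd rfl h
  closed_of_still _ := (t_rev e).symm
  float i _ h := by
    fin_cases i
    exact absurd rfl h
  resume _ _ _ h := absurd rfl h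
  start _ h := absurd rfl h
  arrive _ h := absurd rfl h

theorem floatingPath_isCircuit (hloop : Γ.Loopless) (e : E) :
    (floatingPath Γ e).toEdgePath.IsCircuit := by
  refine ⟨(t_rev e).symm, ?_⟩
  have h0 : Γ.t ((floatingPath Γ e).edge 0) = Γ.t e := rfl
  have h1 : Γ.t ((floatingPath Γ e).edge 1) = Γ.o e := t_rev e
  intro i j hij
  change Fin 2 at i j
  fin_cases i <;> fin_cases j
  · rfl
  · exact absurd (h1.symm.trans (hij.symm.trans h0)) (hloop e)
  · exact absurd (h1.symm.trans (hij.trans h0)) (hloop e)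
  · rfl

theorem floatingPath_occupation (e : E) :
    (floatingPath Γ e).occupation = Measure.dirac (Γ.pt e 0) := by
  have hz : ∀ i : Fin 2, Γ.pt ((floatingPath Γ e).edge i) 0 = Γ.pt e 0 := by
    intro i
    fin_cases i
    · rfl
    · exact pt_zero_rev Γ e
  have h : (floatingPath Γ e).occupation =
      (∑ i, ENNReal.ofReal ((floatingPath Γ e).time i / (floatingPath Γ e).totalTime)) •
        Measure.dirac (Γ.pt e 0) := by
    rw [Finset.sum_smul]
    exact Finset.sum_congr rfl fun i _ => by rw [← hz i]; rfl
  rw [h, ← ENNReal.ofReal_sum_of_nonneg fun i _ => (floatingPath Γ e).weight_nonneg i,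
    (floatingPath Γ e).sum_weight, ENNReal.ofReal_one, one_smul]

theorem ParamPath.occupation_mem_closedMeasures (ξ : Γ.ParamPath)
    (hclosed : ξ.origin = ξ.terminus) (hq : ∀ i, ξ.speed i ≠ 0) :
    ξ.occupation ∈ Γ.closedMeasures := by
  refine atomic_mem_closedMeasures ξ.weight_nonneg ξ.sum_weight fun f => ?_
  simp_rw [cochainFun_pt, ← mul_assoc, ξ.weight_mul_speed (hq _), ← Finset.mul_sum]
  rw [ξ.toEdgePath.sum_d, hclosed, sub_self, mul_zero]

theorem smul_dirac_le (μ : Measure Γ.Tangent) (z : Γ.Tangent) :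
    μ {z} • Measure.dirac z ≤ μ := by
  classical
  refine Measure.le_iff.2 fun s hs => ?_
  rw [Measure.smul_apply, Measure.dirac_apply' z hs, smul_eq_mul]
  by_cases hz : z ∈ s
  · rw [indicator_of_mem hz, Pi.one_apply, mul_one]
    exact measure_mono (singleton_subset_iff.2 hz)
  · simp [hz]

/-- A measure that charges the finitely many points `zᵢ` dominates a multiple of every
probability carried by them. -/
theorem exists_smul_atomic_le {ι : Type*} [Fintype ι] [Nonempty ι] {w : ι → ℝ}
    {z : ι → Γ.Tangent} (hw : ∀ i, w i ≤ 1) {μ : Measure Γ.Tangent} [IsFiniteMeasure μ]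
    (hz : ∀ i, μ {z i} ≠ 0) : ∃ l : ℝ≥0, l ≠ 0 ∧ l • atomic w z ≤ μ := by
  obtain ⟨i₀, hi₀⟩ := Finite.exists_min fun i => (μ {z i}).toNNReal
  set m := (μ {z i₀}).toNNReal
  have hm : m ≠ 0 := (ENNReal.toNNReal_ne_zero.2 ⟨hz i₀, measure_ne_top _ _⟩)
  have hN : (Fintype.card ι : ℝ≥0) ≠ 0 := by exact_mod_cast Fintype.card_ne_zero
  refine ⟨(Fintype.card ι : ℝ≥0)⁻¹ * m, mul_ne_zero (inv_ne_zero hN) hm, ?_⟩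
  have hterm : ∀ i s, m * (ENNReal.ofReal (w i) * Measure.dirac (z i) s) ≤ μ s := fun i s => by
    refine le_trans ?_ (smul_dirac_le μ (z i) s)
    rw [Measure.smul_apply, smul_eq_mul, ← mul_assoc]
    refine mul_le_mul' ?_ le_rfl
    calc (m : ℝ≥0∞) * ENNReal.ofReal (w i) ≤ μ {z i} * 1 :=
          mul_le_mul' ((ENNReal.coe_le_coe.2 (hi₀ i)).trans_eq
            (ENNReal.coe_toNNReal (measure_ne_top _ _))) (ENNReal.ofReal_le_one.2 (hw i))
      _ = μ {z i} := mul_one _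
  refine fun s => ?_
  rw [Measure.smul_apply, ENNReal.smul_def, smul_eq_mul, ENNReal.coe_mul, atomic,
    Measure.finsetSum_apply, mul_assoc, Finset.mul_sum]
  calc ((Fintype.card ι : ℝ≥0)⁻¹ : ℝ≥0) *
        ∑ i, (m : ℝ≥0∞) * (ENNReal.ofReal (w i) • Measure.dirac (z i)) s
      ≤ ((Fintype.card ι : ℝ≥0)⁻¹ : ℝ≥0) * ∑ _ : ι, μ s :=
        mul_le_mul' le_rfl (Finset.sum_le_sum fun i _ => hterm i s)
    _ = μ s := by
        rw [Finset.sum_const, Finset.card_univ, nsmul_eq_mul, ← mul_assoc,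
          ← ENNReal.coe_natCast, ← ENNReal.coe_mul, inv_mul_cancel₀ hN, ENNReal.coe_one, one_mul]

end DirGraph

namespace Hamiltonian

open DirGraph

variable {V E : Type*} {Γ : DirGraph V E} (H : Hamiltonian Γ)

/-! ### Irreducible minimizing measures -/

theorem modLagrangian_of_speed_eq {ω : Γ.cochain1} {a : ℝ} {e : E} {q : ℝ≥0}
    (ha : H.toFun e (H.pMin e) ≤ a) (hq : (q : ℝ) = deriv (H.toFun e) (H.sigma e a)) :
    H.modLagrangian ω (Γ.pt e q) = q * (H.sigma e a - (ω : E → ℝ) e) - a := by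
  rw [modLagrangian_pt, hq, H.lagrangian_deriv, H.toFun_sigma ha]
  ring

/-- A circuit of zero intrinsic length at level `a`, run at the speeds prescribed by the level, has
action `-a`. -/
theorem action_occupation {ω : Γ.cochain1} {a : ℝ} (ha : ∀ e, H.toFun e (H.pMin e) ≤ a)
    (ξ : Γ.ParamPath) (hξ : ξ.toEdgePath.IsCircuit)
    (hlen : H.intrinsicLength ω ξ.toEdgePath a = 0)
    (hq : ∀ i, (ξ.speed i : ℝ) = deriv (H.toFun (ξ.edge i)) (H.sigma (ξ.edge i) a)) :
    H.action ω ξ.occupation = ((-a : ℝ) : EReal) := by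
  rw [ξ.occupation_eq_atomic, H.action_atomic ξ.weight_nonneg, EReal.coe_eq_coe_iff]
  simp_rw [H.modLagrangian_of_speed_eq (ha _) (hq _)]
  rcases ξ.moving_or_still hξ with h | h
  · simp_rw [mul_sub _ _ a, ← mul_assoc, ξ.weight_mul_speed (h _)]
    rw [Finset.sum_sub_distrib, ← Finset.mul_sum, ← Finset.sum_mul, ξ.sum_weight]
    change 1 / ξ.totalTime * H.intrinsicLength ω ξ.toEdgePath a - 1 * a = -a
    rw [hlen]
    ring
  · simp_rw [h, NNReal.coe_zero, zero_mul, zero_sub]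
    rw [← Finset.sum_mul, ξ.sum_weight, one_mul]

/-- A minimizing measure is carried by the edges on which a subsolution is calibrated, at the
speeds prescribed by the level: there, equality holds in Fenchel's inequality. -/
theorem ae_calibrated [Finite E] {ω : Γ.cochain1} {a : ℝ} {u : V → ℝ}
    (hu : ∀ e, H.toFun e ((Γ.d u : E → ℝ) e + (ω : E → ℝ) e) ≤ a) {μ : Measure Γ.Tangent}
    (hμ : μ ∈ Γ.closedMeasures) (hact : H.action ω μ = ((-a : ℝ) : EReal)) :
    ∀ᵐ z ∂μ, ∃ e, z = Γ.pt e (deriv (H.toFun e) (H.sigma e a)).toNNReal ∧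
      (Γ.d u : E → ℝ) e + (ω : E → ℝ) e = H.sigma e a := by
  have := hμ.1.1
  have hint : Integrable (H.modLagrangian ω) μ := by
    by_contra h
    rw [H.action_of_not_integrable hμ.1 h] at hact
    exact EReal.coe_ne_top _ hact.symm
  rw [H.action_of_integrable hint, EReal.coe_eq_coe_iff] at hact
  have hi := integrable_cochainFun hμ.1 (Γ.d u)
  have hi' : Integrable (fun z => Γ.cochainFun (Γ.d u) z - a) μ := hi.sub (integrable_const a)
  have h0 : ∫ z, (H.modLagrangian ω z - (Γ.cochainFun (Γ.d u) z - a)) ∂μ = 0 := by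
    rw [integral_sub hint hi', integral_sub hi (integrable_const a), hμ.2, hact]
    simp
  have hae := (integral_eq_zero_iff_of_nonneg
    (fun z => sub_nonneg.2 (H.cochainFun_sub_le hu z)) (hint.sub hi')).1 h0
  filter_upwards [hae] with z hz
  obtain ⟨e, q, rfl⟩ := exists_pt_eq z
  rw [Pi.zero_apply, modLagrangian_pt, cochainFun_pt] at hz
  set p := (Γ.d u : E → ℝ) e + (ω : E → ℝ) e with hp
  have h1 := hu e
  have h2 : H.lagrangian e q = p * q - a := by
    rw [hp]
    linarith
  have h3 : H.toFun e p = a := by linarith [H.le_lagrangian e p q]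
  have h4 : (q : ℝ) = deriv (H.toFun e) p := H.eq_deriv_of_lagrangian_le (by rw [h2, h3])
  have h5 : H.sigma e a = p := H.sigma_eq h3 (h4 ▸ q.2)
  exact ⟨e, by rw [h5, ← h4, Real.toNNReal_coe], h5.symm⟩

/-- An irreducible minimizing measure charges either a zero vector, and is its Dirac measure, or
only moving vectors. In the latter case the charged edges form, by conservation of the flow, a set
in which every edge can be continued; it contains a circuit, whose occupation measure is dominated
by a multiple of the given one, hence equal to it. -/
theorem exists_circuit_of_irreducible [Finite V] [Finite E] (hloop : Γ.Loopless) {ω : Γ.cochain1}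
    {a : ℝ} {u : V → ℝ} (hu : ∀ e, H.toFun e ((Γ.d u : E → ℝ) e + (ω : E → ℝ) e) ≤ a)
    {μ : Measure Γ.Tangent} (hμ : Γ.Irreducible μ) (hact : H.action ω μ = ((-a : ℝ) : EReal)) :
    ∃ ξ : Γ.ParamPath, ξ.toEdgePath.IsCircuit ∧ H.intrinsicLength ω ξ.toEdgePath a = 0 ∧
      (∀ i, (ξ.speed i : ℝ) = deriv (H.toFun (ξ.edge i)) (H.sigma (ξ.edge i) a)) ∧
      μ = ξ.occupation := by
  classical
  have hμc : μ ∈ Γ.closedMeasures := hμ.1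
  have := hμc.1.1
  have ha : ∀ e, H.toFun e (H.pMin e) ≤ a := fun e => (H.pMin_le e _).trans (hu e)
  set Q : E → ℝ≥0 := fun e => (deriv (H.toFun e) (H.sigma e a)).toNNReal with hQdef
  have hQ : ∀ e, (Q e : ℝ) = deriv (H.toFun e) (H.sigma e a) := fun e =>
    Real.coe_toNNReal _ (H.deriv_sigma_nonneg (ha e))
  set A : Set E := {e | μ {Γ.pt e (Q e)} ≠ 0 ∧
    (Γ.d u : E → ℝ) e + (ω : E → ℝ) e = H.sigma e a} with hA
  have hae : ∀ᵐ z ∂μ, ∃ e ∈ A, z = Γ.pt e (Q e) := by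
    have hcharge : ∀ e, ∀ᵐ z ∂μ, z = Γ.pt e (Q e) → μ {Γ.pt e (Q e)} ≠ 0 := fun e => by
      by_cases h : μ {Γ.pt e (Q e)} = 0
      · filter_upwards [measure_eq_zero_iff_ae_notMem.1 h] with z hz hz'
        exact absurd (mem_singleton_iff.2 hz') hz
      · exact Eventually.of_forall fun _ _ => h
    filter_upwards [H.ae_calibrated hu hμc hact, ae_all_iff.2 hcharge] with z ⟨e, he, hcal⟩ hz
    exact ⟨e, ⟨hz e he, hcal⟩, he⟩
  by_cases hzero : ∃ e ∈ A, Q e = 0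
  · obtain ⟨e, he, hQe⟩ := hzero
    have hd : deriv (H.toFun e) (H.sigma e a) = 0 := by rw [← hQ, hQe, NNReal.coe_zero]
    have hs := H.sigma_rev_of_deriv_eq_zero (ha e) hd
    refine ⟨floatingPath Γ e, floatingPath_isCircuit hloop e, ?_, ?_, ?_⟩
    · change ∑ i : Fin 2, (H.sigma (![e, Γ.rev e] i) a - (ω : E → ℝ) (![e, Γ.rev e] i)) = 0
      rw [Fin.sum_univ_two]
      change H.sigma e a - (ω : E → ℝ) e + (H.sigma (Γ.rev e) a - (ω : E → ℝ) (Γ.rev e)) = 0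
      rw [hs, ω.2 e]
      ring
    · intro i
      change (0 : ℝ) = deriv (H.toFun (![e, Γ.rev e] i)) (H.sigma (![e, Γ.rev e] i) a)
      change Fin 2 at i
      fin_cases i
      · exact hd.symm
      · change 0 = deriv (H.toFun (Γ.rev e)) (H.sigma (Γ.rev e) a)
        rw [hs, H.deriv_rev, hd, neg_zero]
    · rw [floatingPath_occupation]
      have hch : μ {Γ.pt e 0} ≠ 0 := hQe ▸ he.1
      refine hμ.eq_of_smul_le (dirac_zero_mem_closedMeasures e)
        (ENNReal.toNNReal_ne_zero.2 ⟨hch, measure_ne_top _ _⟩) (le_trans (fun s => ?_)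
          (smul_dirac_le μ (Γ.pt e 0)))
      rw [Measure.smul_apply, ENNReal.smul_def, ENNReal.coe_toNNReal (measure_ne_top _ _),
        Measure.smul_apply]
  · push Not at hzero
    have hne : A.Nonempty := by
      obtain ⟨z, e, he, -⟩ := hae.exists
      exact ⟨e, he⟩
    have hsucc : ∀ e ∈ A, ∃ f ∈ A, Γ.o f = Γ.t e := by
      intro e he
      by_contra hcon
      push Not at hcon
      -- mass flows into the vertex `t(e)`, and none flows out
      set g : V → ℝ := Pi.single (Γ.t e) 1 with hg
      have hnn : 0 ≤ᵐ[μ] Γ.cochainFun (Γ.d g) := by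
        filter_upwards [hae] with z ⟨f, hf, hz⟩
        have h1 : g (Γ.o f) = 0 := Pi.single_eq_of_ne (hcon f hf) _
        have h2 : 0 ≤ g (Γ.t f) := by
          rw [hg, Pi.single_apply]
          split_ifs <;> norm_num
        rw [hz, cochainFun_pt, d_apply, h1, sub_zero]
        exact mul_nonneg (Q f).2 h2
      have h0 := (integral_eq_zero_iff_of_nonneg_ae hnn
        (integrable_cochainFun hμc.1 (Γ.d g))).1 (hμc.2 g)
      refine he.1 (measure_mono_null (singleton_subset_iff.2 ?_) (ae_iff.1 h0))
      have h1 : g (Γ.o e) = 0 := Pi.single_eq_of_ne (hcon e he) _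
      have h2 : g (Γ.t e) = 1 := Pi.single_eq_same _ _
      change ¬ Γ.cochainFun (Γ.d g) (Γ.pt e (Q e)) = 0
      rw [cochainFun_pt, d_apply, h1, h2, sub_zero, mul_one]
      exact NNReal.coe_ne_zero.2 (hzero e he)
    obtain ⟨ζ, hζ, hζA⟩ := exists_circuit_of_successor hne hsucc
    have hmove : ∀ i, Q (ζ.edge i) ≠ 0 := fun i => hzero _ (hζA i)
    refine ⟨ζ.moving (fun i => Q (ζ.edge i)) hmove, hζ, ?_, fun i => hQ _, ?_⟩
    · change ∑ i, (H.sigma (ζ.edge i) a - (ω : E → ℝ) (ζ.edge i)) = 0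
      have hcal : ∀ i, H.sigma (ζ.edge i) a - (ω : E → ℝ) (ζ.edge i) =
          (Γ.d u : E → ℝ) (ζ.edge i) := fun i => by
        rw [← (hζA i).2, add_sub_cancel_right]
      rw [Finset.sum_congr rfl fun i _ => hcal i, ζ.sum_d, hζ.1, sub_self]
    · set ξ := ζ.moving (fun i => Q (ζ.edge i)) hmove
      have hcl : ξ.occupation ∈ Γ.closedMeasures :=
        ξ.occupation_mem_closedMeasures hζ.1 hmove
      have hw1 : ∀ i, ξ.time i / ξ.totalTime ≤ 1 := fun i =>
        (div_le_one ξ.totalTime_pos).2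
          (Finset.single_le_sum (fun i _ => (ξ.time_pos i).le) (Finset.mem_univ i))
      obtain ⟨l, hl, hle⟩ := exists_smul_atomic_le (μ := μ)
        (z := fun i => Γ.pt (ξ.edge i) (ξ.speed i)) hw1 fun i => (hζA i).1
      exact hμ.eq_of_smul_le hcl hl hle

end Hamiltonian

end MatherGraph

theorem theorem8p1 {V E : Type*} [Finite V] [Fintype E] [Nonempty E]
    (Γ : MatherGraph.DirGraph V E) (hconn : Γ.Connected) (hloop : Γ.Loopless)
    (H : MatherGraph.Hamiltonian Γ)
    (c : Γ.Cohomology1) (ω : Γ.cochain1) (hω : Γ.cohClass ω = c) :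
    IsLeast (H.action ω '' Γ.closedMeasures) ((-H.alpha c : ℝ) : EReal) ∧
    IsLeast {a : ℝ | ∃ u : V → ℝ, H.IsSubsolution ω a u} (H.criticalValue c) ∧
    H.criticalValue c = H.alpha c ∧
    ∀ μ : MeasureTheory.Measure Γ.Tangent, Γ.Irreducible μ →
      (μ ∈ H.matherMeasures c ↔
        ∃ ξ : Γ.ParamPath, ξ.toEdgePath.IsCircuit ∧
          H.intrinsicLength ω ξ.toEdgePath (H.alpha c) = 0 ∧
          (∀ i, (ξ.speed i : ℝ) =
            deriv (H.toFun (ξ.edge i)) (H.sigma (ξ.edge i) (H.alpha c))) ∧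
          μ = ξ.occupation) := by
  subst hω
  obtain ⟨u, a, hu, hmin, μ₀, hμ₀, hact₀⟩ := H.exists_minimizer ω
  have hle : ∀ μ ∈ Γ.closedMeasures, ((-a : ℝ) : EReal) ≤ H.action ω μ := fun μ hμ =>
    H.neg_le_action hu hμ
  have hα : H.alpha (Γ.cohClass ω) = a := H.alpha_eq hle ⟨μ₀, hμ₀, hact₀⟩
  have hlevels : IsLeast (H.subsolutionLevels ω) a := H.isLeast_subsolutionLevels hu hmin
  have hcrit : H.criticalValue (Γ.cohClass ω) = a := by
    rw [H.criticalValue_cohClass, hlevels.csInf_eq]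
  rw [hα, hcrit]
  refine ⟨⟨⟨μ₀, hμ₀, hact₀⟩, ?_⟩, hlevels, rfl, fun μ hμ => ⟨fun h => ?_, ?_⟩⟩
  · rintro _ ⟨μ, hμ, rfl⟩
    exact hle μ hμ
  · refine H.exists_circuit_of_irreducible hloop hu hμ ?_
    rw [h.2 ω rfl, hα]
  · rintro ⟨ξ, hξ, hlen, hq, rfl⟩
    refine ⟨hμ.1, fun ω' hω' => ?_⟩
    rw [H.action_eq_of_cohClass_eq hω' hμ.1, hα]
    exact H.action_occupation (fun e => (H.pMin_le e _).trans (hu e)) ξ hξ hlen hq
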